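/- **Setting.** Manifolds are smooth ($C^\infty$) real Banach manifolds without boundary. Let $\pi:E\to M$ be a smooth Banach vector bundle, with fibres $E_m=\pi^{-1}(m)$. For a map $f$ of manifolds, $Tf$ denotes its tangent map. Let $\pi^*E=\{(a,b)\in E\times E:\pi(a)=\pi(b)\}$ and let $\pi^*\pi:\pi^*E\to E$, $(a,b)\mapsto a$, be the pullback bundle. Identify $T(\pi^*E)$ with $\{(w_1,w_2)\in TE\times TE: T\pi(w_1)=T\pi(w_2)\}$ by means of the tangent maps of the two projections $\pi^*E\to E$. The differentials of the addition $\pi^*E\to E$, $(a,b)\mapsto a+b$, and of the multiplications $E\to E$, $a\mapsto\lambda a$ ($\lambda\in\mathbb R$), are denoted by $+_\tau$ and $\lambda\,\cdot_\tau$. They are the operations of the vector bundle $T\pi:TE\to TM$. For $v,w\in TE$ with $T\pi(v)=T\pi(w)$ put $$\xi^V_{T\pi}(v,w)=\frac{d}{ds}\big(v+_\tau s\cdot_\tau w\big)\Big|_{s=0}\in T(TE),$$ and let $\nu_{T\pi}$ be the map defined on these vectors by $\nu_{T\pi}(\xi^V_{T\pi}(v,w))=w$. An *Ehresmann connection* on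 $\pi$ (in general nonlinear) is given by its horizontal lift $\xi:\pi^*TM\to TE$, where $\pi^*TM=\{(a,v):a\in E,\ v\in T_{\pi(a)}M\}$. This is a smooth map such that, for every $a\in E$, $v\mapsto\xi(a,v)$ is a linear map $T_{\pi(a)}M\to T_aE$ with $T\pi(\xi(a,v))=v$. The connection is *linear* if $$\xi(a+a',v)=\xi(a,v)+_\tau\xi(a',v)\qquad\text{and}\qquad \xi(\lambda a,v)=\lambda\cdot_\tau\xi(a,v)$$ for all $m\in M$, $a,a'\in E_m$, $v\in T_mM$ and $\lambda\in\mathbb R$. The same definitions apply to the vector bundle $\pi^*\pi:\pi^*E\to E$. **Theorem.** Let $\mathrm{Hor}$ be an Ehresmann connection on $\pi:E\to M$ with horizontal lift $\xi^H$. For $(a,b)\in\pi^*E$ and $w\in T_aE$ set $$B(a,b)w=\nu_{T\pi}\left(\frac{d}{ds}\,\xi^H\big(a+sb,\,T\pi(w)\big)\Big|_{s=0}\right)\in TE .$$ Then the map $((a,b),w)\mapsto(w,B(a,b)w)$ is the horizontal lift of a linear Ehresmann connection on the pullback bundle $\pi^*\pi:\pi^*E\to E$. In particular $B(a,b)w$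 is well defined, lies in $T_bE$, and satisfies $T\pi(B(a,b)w)=T\pi(w)$. -/

import Mathlib

set_option linter.unusedSectionVars false
open Bundle
open scoped Manifold ContDiff

noncomputable section

namespace NonlinearConnection

section Bundles

variable {EB : Type*} [NormedAddCommGroup EB] [NormedSpace ℝ EB]
  {HB : Type*} [TopologicalSpace HB] (I : ModelWithCorners ℝ EB HB)
  {M : Type*} [TopologicalSpace M] [ChartedSpace HB M]
  (F : Type*) [NormedAddCommGroup F] [NormedSpace ℝ F]
  (E : M → Type*) [TopologicalSpace (TotalSpace F E)]
  [∀ x, AddCommMonoid (E x)] [∀ x, Module ℝ (E x)] [∀ x, TopologicalSpace (E x)]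
  [FiberBundle F E] [VectorBundle ℝ F E]
  [IsManifold I ∞ M] [ContMDiffVectorBundle ∞ F E I]

/-- The projection `π : E → M` of a smooth vector bundle, as a smooth map of manifolds. -/
def bundleProj : C^∞⟮I.prod 𝓘(ℝ, F), TotalSpace F E; I, M⟯ :=
  ⟨TotalSpace.proj, contMDiff_proj E⟩

/-- The family of fibres of the pullback bundle `π^*E → E`: the fibre over `a` is `E_{π(a)}`. -/
abbrev PullFibre : TotalSpace F E → Type _ := (bundleProj I F E : TotalSpace F E → M) *ᵖ E

/-- The total space `π^*E`, whose points are the pairs `(a, b)` with `π(a) = π(b)`. -/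
abbrev PullSpace : Type _ := TotalSpace F (PullFibre I F E)

/-- The total space `π^*TM`, whose points are the pairs `(a, v)` with `v ∈ T_{π(a)}M`. -/
abbrev PullTangent : Type _ :=
  TotalSpace EB ((bundleProj I F E : TotalSpace F E → M) *ᵖ (TangentSpace I : M → Type _))

/-- The tangent bundle `TE` of the total space. -/
abbrev TE : Type _ := TangentBundle (I.prod 𝓘(ℝ, F)) (TotalSpace F E)

/-- The tangent bundle `TTE = T(TE)`. -/
abbrev TTE : Type _ := TangentBundle (I.prod 𝓘(ℝ, F)).tangent (TE I F E)

/-- The tangent bundle `T(π^*E)`. -/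
abbrev TPull : Type _ := TangentBundle ((I.prod 𝓘(ℝ, F)).prod 𝓘(ℝ, F)) (PullSpace I F E)

variable {F E}

/-- First projection `(a, b) ↦ a`, which is also the bundle projection of `π^*E → E`. -/
def pullFst (P : PullSpace I F E) : TotalSpace F E := P.proj

/-- Second projection `(a, b) ↦ b`. -/
def pullSnd (P : PullSpace I F E) : TotalSpace F E := ⟨P.proj.proj, P.2⟩

/-- The addition `(a, b) ↦ a + b` of the vector bundle, as a map `π^*E → E`. -/
def fibreAdd (P : PullSpace I F E) : TotalSpace F E :=
  let b : E P.proj.proj := P.2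
  ⟨P.proj.proj, P.proj.2 + b⟩

/-- The multiplication `a ↦ r a` of the vector bundle, as a map `E → E`. -/
def fibreSmul (r : ℝ) (a : TotalSpace F E) : TotalSpace F E := ⟨a.proj, r • a.2⟩

variable (F E)

/-- The tangent map `Tπ : TE → TM`. -/
def tangentProj : TE I F E → TangentBundle I M :=
  tangentMap (I.prod 𝓘(ℝ, F)) I (TotalSpace.proj : TotalSpace F E → M)

/-- The set `(Tπ)^*(TE)` of pairs `(u, v)` in `TE × TE` with `Tπ(u) = Tπ(v)`. -/
abbrev TProj2 : Type _ :=
  {p : TE I F E × TE I F E // tangentProj I F E p.1 = tangentProj I F E p.2}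

variable {F E}

lemma contMDiff_pullFst : ContMDiff ((I.prod 𝓘(ℝ, F)).prod 𝓘(ℝ, F)) (I.prod 𝓘(ℝ, F)) ∞
    (pullFst I : PullSpace I F E → TotalSpace F E) :=
  contMDiff_proj _

lemma contMDiff_pullSnd : ContMDiff ((I.prod 𝓘(ℝ, F)).prod 𝓘(ℝ, F)) (I.prod 𝓘(ℝ, F)) ∞
    (pullSnd I : PullSpace I F E → TotalSpace F E) := by
  intro P
  rw [contMDiffAt_totalSpace]
  constructor
  · exact ((contMDiff_proj E).comp (contMDiff_pullFst I)) P
  · have h := (contMDiffAt_totalSpace (F := F) (E := PullFibre I F E)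
      (IM := (I.prod 𝓘(ℝ, F)).prod 𝓘(ℝ, F)) (IB := I.prod 𝓘(ℝ, F)) (n := ∞)
      (f := fun Q : PullSpace I F E => Q) (x₀ := P)).1 contMDiffAt_id
    exact h.2

lemma contMDiff_fibreSmul (r : ℝ) : ContMDiff (I.prod 𝓘(ℝ, F)) (I.prod 𝓘(ℝ, F)) ∞
    (fibreSmul r : TotalSpace F E → TotalSpace F E) := by
  intro a
  rw [contMDiffAt_totalSpace]
  have h := (contMDiffAt_totalSpace (F := F) (E := E)
      (IM := I.prod 𝓘(ℝ, F)) (IB := I) (n := ∞)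
      (f := fun Q : TotalSpace F E => Q) (x₀ := a)).1 contMDiffAt_id
  refine ⟨h.1, ((contMDiffAt_const (I' := 𝓘(ℝ, ℝ)) (c := r)).smul h.2).congr_of_eventuallyEq ?_⟩
  have hb : ∀ᶠ x : TotalSpace F E in nhds a, x.proj ∈ (trivializationAt F E a.proj).baseSet :=
    (FiberBundle.continuous_proj F E).continuousAt.eventually
      ((trivializationAt F E a.proj).open_baseSet.mem_nhds
        (FiberBundle.mem_baseSet_trivializationAt' _))
  filter_upwards [hb] with x hx
  exact ((trivializationAt F E a.proj).linear ℝ hx).map_smul r x.2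

lemma tangentProj_tangentMap_fibreSmul (r : ℝ) (w : TE I F E) :
    tangentProj I F E (tangentMap (I.prod 𝓘(ℝ, F)) (I.prod 𝓘(ℝ, F)) (fibreSmul r) w) =
      tangentProj I F E w := by
  have h := tangentMap_comp_at (I := I.prod 𝓘(ℝ, F)) (I' := I.prod 𝓘(ℝ, F)) (I'' := I)
    (f := (fibreSmul r : TotalSpace F E → TotalSpace F E))
    (g := (TotalSpace.proj : TotalSpace F E → M)) w
    ((contMDiff_proj (F := F) (n := ∞) (IB := I) E).mdifferentiable (by simp) _)
    ((contMDiff_fibreSmul I r).mdifferentiable (by simp) _)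
  exact h.symm

lemma tangentProj_fst_eq_snd (W : TPull I F E) :
    tangentProj I F E
        (tangentMap ((I.prod 𝓘(ℝ, F)).prod 𝓘(ℝ, F)) (I.prod 𝓘(ℝ, F)) (pullFst I) W) =
      tangentProj I F E
        (tangentMap ((I.prod 𝓘(ℝ, F)).prod 𝓘(ℝ, F)) (I.prod 𝓘(ℝ, F)) (pullSnd I) W) := by
  have hp := (contMDiff_proj (F := F) (n := ∞) (IB := I) E).mdifferentiable (by simp)
  have h1 := tangentMap_comp_at (I := (I.prod 𝓘(ℝ, F)).prod 𝓘(ℝ, F))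
    (I' := I.prod 𝓘(ℝ, F)) (I'' := I)
    (f := (pullFst I : PullSpace I F E → TotalSpace F E))
    (g := (TotalSpace.proj : TotalSpace F E → M)) W (hp _)
    ((contMDiff_pullFst I).mdifferentiable (by simp) _)
  have h2 := tangentMap_comp_at (I := (I.prod 𝓘(ℝ, F)).prod 𝓘(ℝ, F))
    (I' := I.prod 𝓘(ℝ, F)) (I'' := I)
    (f := (pullSnd I : PullSpace I F E → TotalSpace F E))
    (g := (TotalSpace.proj : TotalSpace F E → M)) W (hp _)
    ((contMDiff_pullSnd I).mdifferentiable (by simp) _)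
  exact h1.symm.trans h2

/-- The canonical map `T(π^*E) → (Tπ)^*(TE)`, which sends a tangent vector of `π^*E` to the pair
of its images under the tangent maps of the two projections. -/
def tangentPair (W : TPull I F E) : TProj2 I F E :=
  ⟨(tangentMap ((I.prod 𝓘(ℝ, F)).prod 𝓘(ℝ, F)) (I.prod 𝓘(ℝ, F)) (pullFst I) W,
    tangentMap ((I.prod 𝓘(ℝ, F)).prod 𝓘(ℝ, F)) (I.prod 𝓘(ℝ, F)) (pullSnd I) W),
    tangentProj_fst_eq_snd I W⟩

lemma mdifferentiable_triv {B : Type*} [TopologicalSpace B] {EB' HB' : Type*}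
    [NormedAddCommGroup EB'] [NormedSpace ℝ EB'] [TopologicalSpace HB']
    {J : ModelWithCorners ℝ EB' HB'} [ChartedSpace HB' B] [IsManifold J ∞ B]
    {V : B → Type*} [TopologicalSpace (TotalSpace F V)]
    [∀ x, AddCommMonoid (V x)] [∀ x, Module ℝ (V x)] [∀ x, TopologicalSpace (V x)]
    [FiberBundle F V] [VectorBundle ℝ F V] [ContMDiffVectorBundle ∞ F V J] (x : B) :
    (trivializationAt F V x).toOpenPartialHomeomorph.MDifferentiable
      (J.prod 𝓘(ℝ, F)) (J.prod 𝓘(ℝ, F)) :=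
  ⟨((trivializationAt F V x).contMDiffOn (IB := J) (n := ∞)).mdifferentiableOn (by simp),
   ((trivializationAt F V x).contMDiffOn_symm (IB := J) (n := ∞)).mdifferentiableOn (by simp)⟩

/-- In a trivialization, the derivative of a vector bundle chart at `a` is determined by the
derivatives of the projection and of the fibre coordinate. -/
lemma mfderiv_triv {B : Type*} [TopologicalSpace B] {EB' HB' : Type*}
    [NormedAddCommGroup EB'] [NormedSpace ℝ EB'] [TopologicalSpace HB']
    {J : ModelWithCorners ℝ EB' HB'} [ChartedSpace HB' B] [IsManifold J ∞ B]
    {V : B → Type*} [TopologicalSpace (TotalSpace F V)]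
    [∀ x, AddCommMonoid (V x)] [∀ x, Module ℝ (V x)] [∀ x, TopologicalSpace (V x)]
    [FiberBundle F V] [VectorBundle ℝ F V] [ContMDiffVectorBundle ∞ F V J]
    (x : B) (a : TotalSpace F V) (ha : a.proj ∈ (trivializationAt F V x).baseSet)
    (w : TangentSpace (J.prod 𝓘(ℝ, F)) a) :
    mfderiv (J.prod 𝓘(ℝ, F)) (J.prod 𝓘(ℝ, F)) (trivializationAt F V x) a w =
      (mfderiv (J.prod 𝓘(ℝ, F)) J (TotalSpace.proj : TotalSpace F V → B) a w,
       mfderiv (J.prod 𝓘(ℝ, F)) 𝓘(ℝ, F) (fun c => (trivializationAt F V x c).2) a w) := by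
  set e := trivializationAt F V x
  have hs : a ∈ e.source := e.mem_source.2 ha
  have he : MDifferentiableAt (J.prod 𝓘(ℝ, F)) (J.prod 𝓘(ℝ, F)) e a :=
    (mdifferentiable_triv (J := J) x).mdifferentiableAt hs
  have h1 : MDifferentiableAt (J.prod 𝓘(ℝ, F)) J (TotalSpace.proj : TotalSpace F V → B) a :=
    (contMDiff_proj (F := F) (n := ∞) (IB := J) V).mdifferentiable (by simp) _
  have h2 : MDifferentiableAt (J.prod 𝓘(ℝ, F)) 𝓘(ℝ, F) (fun c => (e c).2) a :=
    mdifferentiableAt_snd.comp a he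
  have h3 : (e : TotalSpace F V → B × F) =ᶠ[nhds a] fun c => (c.proj, (e c).2) := by
    filter_upwards [e.open_source.mem_nhds hs] with c hc
    exact (e.mk_proj_snd hc).symm
  have h4 := mfderiv_prodMk h1 h2
  rw [h3.mfderiv_eq, h4]
  rfl

/-- The derivative of the vector bundle chart of `π^*E` at `P`, through the two projections. -/
lemma mfderiv_triv_pull (P : PullSpace I F E)
    (X : TangentSpace ((I.prod 𝓘(ℝ, F)).prod 𝓘(ℝ, F)) P) :
    mfderiv ((I.prod 𝓘(ℝ, F)).prod 𝓘(ℝ, F)) ((I.prod 𝓘(ℝ, F)).prod 𝓘(ℝ, F))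
      (trivializationAt F (PullFibre I F E) P.proj) P X =
      (mfderiv ((I.prod 𝓘(ℝ, F)).prod 𝓘(ℝ, F)) (I.prod 𝓘(ℝ, F)) (pullFst I) P X,
       mfderiv (I.prod 𝓘(ℝ, F)) 𝓘(ℝ, F)
        (fun c => (trivializationAt F E P.proj.proj c).2) (pullSnd I P)
        (mfderiv ((I.prod 𝓘(ℝ, F)).prod 𝓘(ℝ, F)) (I.prod 𝓘(ℝ, F)) (pullSnd I) P X)) := by
  have h := mfderiv_triv (F := F) (J := I.prod 𝓘(ℝ, F)) (V := PullFibre I F E) P.proj P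
    (FiberBundle.mem_baseSet_trivializationAt' _) X
  have hs : pullSnd I P ∈ (trivializationAt F E P.proj.proj).source :=
    (trivializationAt F E P.proj.proj).mem_source.2 (FiberBundle.mem_baseSet_trivializationAt' _)
  have h2 : MDifferentiableAt (I.prod 𝓘(ℝ, F)) 𝓘(ℝ, F)
      (fun c => (trivializationAt F E P.proj.proj c).2) (pullSnd I P) :=
    mdifferentiableAt_snd.comp _ ((mdifferentiable_triv (J := I) _).mdifferentiableAt hs)
  have h3 := mfderiv_comp (I := (I.prod 𝓘(ℝ, F)).prod 𝓘(ℝ, F)) (I' := I.prod 𝓘(ℝ, F))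
    (I'' := 𝓘(ℝ, F)) P h2 ((contMDiff_pullSnd I (F := F) (E := E)).mdifferentiable (by simp) P)
  rw [h]
  exact Prod.ext rfl (DFunLike.congr_fun h3 X)

lemma tangentPair_bijective :
    Function.Bijective (tangentPair I : TPull I F E → TProj2 I F E) := by
  constructor
  · rintro ⟨P, X⟩ ⟨P', X'⟩ h
    obtain ⟨h1, h2⟩ := Prod.ext_iff.1 (Subtype.ext_iff.1 h)
    have hP : P = P' := by
      have e1 : pullFst I P = pullFst I P' :=
        congrArg (TotalSpace.proj : TE I F E → TotalSpace F E) h1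
      have e2 : pullSnd I P = pullSnd I P' := congrArg TotalSpace.proj h2
      obtain ⟨a, b⟩ := P
      obtain ⟨a', b'⟩ := P'
      obtain rfl : a = a' := e1
      have : b = b' := eq_of_heq (TotalSpace.mk.inj e2).2
      rw [this]
    subst hP
    have h1' := eq_of_heq (TotalSpace.mk.inj h1).2
    have h2' := eq_of_heq (TotalSpace.mk.inj h2).2
    have hinj := (mdifferentiable_triv (F := F) (J := I.prod 𝓘(ℝ, F)) (V := PullFibre I F E)
      P.proj).mfderiv_injective (x := P)
      ((Trivialization.mem_source _).2 (FiberBundle.mem_baseSet_trivializationAt' _))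
    have : X = X' := by
      apply hinj
      refine (mfderiv_triv_pull I P X).trans (Eq.trans ?_ (mfderiv_triv_pull I P X').symm)
      dsimp only at h1' h2'
      rw [h1', h2']
    rw [this]
  · rintro ⟨⟨⟨⟨m, a⟩, u⟩, ⟨⟨m', b⟩, v⟩⟩, h⟩
    obtain rfl : m = m' := congrArg TotalSpace.proj h
    have h' := eq_of_heq (TotalSpace.mk.inj h).2
    dsimp only at h'
    let P : PullSpace I F E := ⟨⟨m, a⟩, b⟩
    obtain ⟨X, hX⟩ := (mdifferentiable_triv (F := F) (J := I.prod 𝓘(ℝ, F))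
      (V := PullFibre I F E) P.proj).mfderiv_surjective (x := P)
      ((Trivialization.mem_source _).2 (FiberBundle.mem_baseSet_trivializationAt' _))
      (u, mfderiv (I.prod 𝓘(ℝ, F)) 𝓘(ℝ, F)
        (fun c => (trivializationAt F E m c).2) (⟨m, b⟩ : TotalSpace F E) v)
    have hX' := (mfderiv_triv_pull I P X).symm.trans hX
    obtain ⟨hu, hv⟩ := Prod.ext_iff.1 hX'
    refine ⟨⟨P, X⟩, Subtype.ext (Prod.ext ?_ ?_)⟩
    · exact congrArg (fun z : TangentSpace (I.prod 𝓘(ℝ, F)) (⟨m, a⟩ : TotalSpace F E) =>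
        (⟨⟨m, a⟩, z⟩ : TE I F E)) hu
    · have hpr := eq_of_heq (TotalSpace.mk.inj (tangentProj_fst_eq_snd I ⟨P, X⟩)).2
      have hinj := (mdifferentiable_triv (F := F) (J := I) (V := E) m).mfderiv_injective
        (x := (⟨m, b⟩ : TotalSpace F E))
        ((Trivialization.mem_source _).2 (FiberBundle.mem_baseSet_trivializationAt' _))
      refine congrArg (fun z : TangentSpace (I.prod 𝓘(ℝ, F)) (⟨m, b⟩ : TotalSpace F E) =>
        (⟨⟨m, b⟩, z⟩ : TE I F E)) (hinj ?_)
      have hb : (⟨m, b⟩ : TotalSpace F E).proj ∈ (trivializationAt F E m).baseSet :=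
        FiberBundle.mem_baseSet_trivializationAt' _
      refine (mfderiv_triv (J := I) m _ hb _).trans
        (Eq.trans (Prod.ext ?_ ?_) (mfderiv_triv (J := I) m _ hb v).symm)
      swap
      · exact hv
      refine hpr.symm.trans (Eq.trans ?_ h')
      exact congrArg (mfderiv (I.prod 𝓘(ℝ, F)) I (TotalSpace.proj : TotalSpace F E → M)
        (⟨m, a⟩ : TotalSpace F E)) hu

/-- The canonical identification `T(π^*E) ≃ (Tπ)^*(TE)`. -/
def tangentEquiv : TPull I F E ≃ TProj2 I F E :=
  Equiv.ofBijective (tangentPair I) (tangentPair_bijective I)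

/-- The addition `u +_τ v` of the vector bundle `Tπ : TE → TM`, defined when `Tπ(u) = Tπ(v)`:
the differential of the addition of the vector bundle `E → M`. -/
def tauAdd (p : TProj2 I F E) : TE I F E :=
  tangentMap ((I.prod 𝓘(ℝ, F)).prod 𝓘(ℝ, F)) (I.prod 𝓘(ℝ, F)) (fibreAdd I)
    ((tangentEquiv I).symm p)

/-- The multiplication `r ·_τ w` of the vector bundle `Tπ : TE → TM`: the differential of the
multiplication by `r` in the vector bundle `E → M`. -/
def tauSmul (r : ℝ) (w : TE I F E) : TE I F E :=
  tangentMap (I.prod 𝓘(ℝ, F)) (I.prod 𝓘(ℝ, F)) (fibreSmul r) w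

lemma tangentProj_tauSmul (r : ℝ) (w : TE I F E) :
    tangentProj I F E (tauSmul I r w) = tangentProj I F E w :=
  tangentProj_tangentMap_fibreSmul I r w

/-- The derivative at `s = 0` of a curve in `TE`, as an element of `TTE`. -/
def velocity (c : ℝ → TE I F E) : TTE I F E :=
  ⟨c 0, mfderiv 𝓘(ℝ, ℝ) (I.prod 𝓘(ℝ, F)).tangent c 0 (1 : ℝ)⟩

/-- The vertical lift of the vector bundle `Tπ : TE → TM`:
`(v, w) ↦ d/ds (v +_τ s ·_τ w) |_{s = 0}`. -/
def tauVerticalLift (p : TProj2 I F E) : TTE I F E :=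
  velocity I fun s =>
    tauAdd I ⟨(p.1.1, tauSmul I s p.1.2), p.2.trans (tangentProj_tauSmul I s p.1.2).symm⟩

open Classical in
/-- The vertical projection `ν_{Tπ} : Ver(Tπ) → TE`, which sends the vertical lift of `(v, w)`
to `w`. Vectors that are not vertical lifts get an irrelevant value. -/
def tauVerticalProj (V : TTE I F E) : TE I F E :=
  if h : ∃ w v : TE I F E, ∃ hvw : tangentProj I F E v = tangentProj I F E w,
    tauVerticalLift I ⟨(v, w), hvw⟩ = V then h.choose else V.proj

variable (F E)

/-- An Ehresmann (in general nonlinear) connection on the vector bundle `π : E → M`, given by its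
horizontal lift `ξ : π^*TM → TE`: a smooth right splitting of the sequence
`0 → π^*E → TE → π^*TM → 0` of vector bundles over `E`. -/
structure EhresmannConnection where
  /-- The horizontal lift `v ↦ ξ(a, v)`, linear on each fibre `T_{π(a)}M` of `π^*TM`. -/
  lift (a : TotalSpace F E) : TangentSpace I a.proj →ₗ[ℝ] TangentSpace (I.prod 𝓘(ℝ, F)) a
  /-- `T_aπ(ξ(a, v)) = v`. -/
  proj_lift (a : TotalSpace F E) (v : TangentSpace I a.proj) :
    mfderiv (I.prod 𝓘(ℝ, F)) I (TotalSpace.proj : TotalSpace F E → M) a (lift a v) = v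
  /-- `ξ` is smooth as a map between the manifolds `π^*TM` and `TE`. -/
  smooth_lift : ContMDiff ((I.prod 𝓘(ℝ, F)).prod 𝓘(ℝ, EB)) (I.prod 𝓘(ℝ, F)).tangent ∞
    (fun p : PullTangent I F E => (⟨p.proj, lift p.proj p.2⟩ : TE I F E))

variable {I F E}

namespace EhresmannConnection

/-- The horizontal lift `ξ(a, v)`, for `a ∈ E_m` and `v ∈ T_mM`, as a point of `TE`. -/
def hor (H : EhresmannConnection I F E) {m : M} (a : E m) (v : TangentSpace I m) : TE I F E :=
  ⟨⟨m, a⟩, H.lift ⟨m, a⟩ v⟩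

lemma tangentProj_hor (H : EhresmannConnection I F E) {m : M} (a : E m)
    (v : TangentSpace I m) : tangentProj I F E (H.hor a v) = ⟨m, v⟩ := by
  have h := H.proj_lift ⟨m, a⟩ v
  simp only [tangentProj, tangentMap, hor]
  exact congrArg (fun u : TangentSpace I m => (⟨m, u⟩ : TangentBundle I M)) h

/-- A connection is linear if `ξ(a + a', v) = ξ(a, v) +_τ ξ(a', v)` and
`ξ(r a, v) = r ·_τ ξ(a, v)`. -/
def IsLinear (H : EhresmannConnection I F E) : Prop :=
  (∀ (m : M) (a a' : E m) (v : TangentSpace I m),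
    H.hor (a + a') v = tauAdd I ⟨(H.hor a v, H.hor a' v),
      (H.tangentProj_hor a v).trans (H.tangentProj_hor a' v).symm⟩) ∧
  ∀ (m : M) (r : ℝ) (a : E m) (v : TangentSpace I m), H.hor (r • a) v = tauSmul I r (H.hor a v)

/-- `B(a, b) w = ν_{Tπ} (d/ds ξ(a + s b, Tπ(w)) |_{s = 0})`, for `a, b ∈ E_m` and `w ∈ T_aE`. -/
def fibreDiff (H : EhresmannConnection I F E) {m : M} (a b : E m)
    (w : TangentSpace (I.prod 𝓘(ℝ, F)) (⟨m, a⟩ : TotalSpace F E)) : TE I F E :=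
  tauVerticalProj I (velocity I fun s => H.hor (a + s • b)
    (mfderiv (I.prod 𝓘(ℝ, F)) I (TotalSpace.proj : TotalSpace F E → M) ⟨m, a⟩ w))

end EhresmannConnection

end Bundles

end NonlinearConnection

end

noncomputable section

namespace NonlinearConnection

/-! The proof is a computation in a bundle chart of `E`. Over the chart, a point of `TE` is a triple
(y, p, q): its image y under `Tπ`, the fibre coordinate p of its base point, and the derivative q of
the fibre coordinate along it. For fixed y, the operations `+_τ` and `·_τ` act componentwise on (p,
q) (`tangentFibreCoord_tauAdd`, `tangentFibreCoord_tauSmul`). Hence the vertical lift of (v, w) is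
the velocity of a straight line in `F × F` with direction the coordinates of w. It therefore
determines w, and `ν_{Tπ}` is well defined (`tauVerticalProj_tauVerticalLift`).

A connection reads ξ(p, y) = (y, p, Γ(y, p)), where Γ, called `localCoeff`, is smooth in both
arguments and linear in y on each tangent space of M. If a, b have coordinates A, B and y = Tπ(w),
the curve s ↦ ξ(a + sb, y) becomes (y, A + sB, Γ(y, A + sB)). Its velocity at 0 is that of a
straight line, so it is a vertical lift, and B(a, b)w = (y, B, D_pΓ(y, A)B) (`fibreDiff_eq`). This
expression is linear in w because Γ is linear in y, linear in b because it is a derivative applied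
to B, and smooth because Γ is.

The lift on `π^*E` is defined pointwise as the tangent vector with chart components w and D_pΓ(y,
A)B, using the chart centred at the point itself. Its image under the second projection is B(a, b)w
(`tangentMap_pullSnd_linearizationLift`), which does not refer to a chart. The same formula thus
holds in every chart around the point, and smoothness can be checked in a fixed one. -/

lemma contMDiffAt_tangentMap_of_isOpen
    {E₁ E₂ H₁ H₂ M₁ M₂ : Type*} [NormedAddCommGroup E₁] [NormedSpace ℝ E₁]
    [NormedAddCommGroup E₂] [NormedSpace ℝ E₂] [TopologicalSpace H₁] [TopologicalSpace H₂]
    {I₁ : ModelWithCorners ℝ E₁ H₁} {I₂ : ModelWithCorners ℝ E₂ H₂}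
    [TopologicalSpace M₁] [ChartedSpace H₁ M₁] [IsManifold I₁ ∞ M₁]
    [TopologicalSpace M₂] [ChartedSpace H₂ M₂] [IsManifold I₂ ∞ M₂]
    {f : M₁ → M₂} {s : Set M₁} (hs : IsOpen s) (hf : ContMDiffOn I₁ I₂ ∞ f s)
    (u : TangentBundle I₁ M₁) (hu : u.proj ∈ s) :
    ContMDiffAt I₁.tangent I₂.tangent ∞ (tangentMap I₁ I₂ f) u := by
  have : IsManifold I₁ 1 M₁ := IsManifold.of_le (n := ∞) (by simp)
  have : IsManifold I₂ 1 M₂ := IsManifold.of_le (n := ∞) (by simp)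
  have h := hf.contMDiffOn_tangentMapWithin (m := ∞) (by simp) hs.uniqueMDiffOn
  have ho : IsOpen (TotalSpace.proj ⁻¹' s : Set (TangentBundle I₁ M₁)) :=
    hs.preimage (FiberBundle.continuous_proj E₁ (TangentSpace I₁ : M₁ → Type _))
  refine (h.contMDiffAt (ho.mem_nhds hu)).congr_of_eventuallyEq ?_
  filter_upwards [ho.mem_nhds hu] with v hv
  exact (tangentMapWithin_eq_tangentMap (hs.uniqueMDiffWithinAt hv)
    ((hf.contMDiffAt (hs.mem_nhds hv)).mdifferentiableAt (by simp))).symm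

lemma tangentMap_congr_of_eventuallyEq
    {E₁ E₂ H₁ H₂ M₁ M₂ : Type*} [NormedAddCommGroup E₁] [NormedSpace ℝ E₁]
    [NormedAddCommGroup E₂] [NormedSpace ℝ E₂] [TopologicalSpace H₁] [TopologicalSpace H₂]
    {I₁ : ModelWithCorners ℝ E₁ H₁} {I₂ : ModelWithCorners ℝ E₂ H₂}
    [TopologicalSpace M₁] [ChartedSpace H₁ M₁]
    [TopologicalSpace M₂] [ChartedSpace H₂ M₂]
    {f g : M₁ → M₂} {u : TangentBundle I₁ M₁} (h : f =ᶠ[nhds u.proj] g) :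
    tangentMap I₁ I₂ f u = tangentMap I₁ I₂ g u := by
  have h2 := DFunLike.congr_fun (h.mfderiv_eq (I := I₁) (I' := I₂)) u.2
  exact TotalSpace.ext h.eq_of_nhds (heq_of_eq h2)

lemma tangentBundle_mk_congr {E₁ H₁ M₁ : Type*} [NormedAddCommGroup E₁] [NormedSpace ℝ E₁]
    [TopologicalSpace H₁] {I₁ : ModelWithCorners ℝ E₁ H₁}
    [TopologicalSpace M₁] [ChartedSpace H₁ M₁] {x : M₁} {u v : TangentSpace I₁ x} (h : u = v) :
    (⟨x, u⟩ : TangentBundle I₁ M₁) = ⟨x, v⟩ := by rw [h]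

/-! ### Coordinates on `TE` induced by a bundle chart of `E`. -/

section Coordinates

variable {EB : Type*} [NormedAddCommGroup EB] [NormedSpace ℝ EB]
  {HB : Type*} [TopologicalSpace HB] (I : ModelWithCorners ℝ EB HB)
  {M : Type*} [TopologicalSpace M] [ChartedSpace HB M]
  {F : Type*} [NormedAddCommGroup F] [NormedSpace ℝ F]
  {E : M → Type*} [TopologicalSpace (TotalSpace F E)]
  [∀ x, AddCommMonoid (E x)] [∀ x, Module ℝ (E x)] [∀ x, TopologicalSpace (E x)]
  [FiberBundle F E] [VectorBundle ℝ F E]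

/-- The fibre coordinate of the preferred trivialization at `x`. -/
def fibreCoord (x : M) (c : TotalSpace F E) : F := (trivializationAt F E x c).2

/-- The differential of the fibre coordinate at `x`, as a function on the tangent bundle. -/
def tangentFibreCoord (x : M) (u : TE I F E) : F :=
  mfderiv (I.prod 𝓘(ℝ, F)) 𝓘(ℝ, F) (fibreCoord x : TotalSpace F E → F) u.proj u.2

variable [IsManifold I ∞ M] [ContMDiffVectorBundle ∞ F E I]

lemma contMDiffOn_fibreCoord (x : M) : ContMDiffOn (I.prod 𝓘(ℝ, F)) 𝓘(ℝ, F) ∞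
    (fibreCoord x : TotalSpace F E → F) (trivializationAt F E x).source :=
  contMDiff_snd.comp_contMDiffOn ((trivializationAt F E x).contMDiffOn (IB := I) (n := ∞))

lemma contMDiffAt_fibreCoord {x : M} {c : TotalSpace F E}
    (hc : c.proj ∈ (trivializationAt F E x).baseSet) :
    ContMDiffAt (I.prod 𝓘(ℝ, F)) 𝓘(ℝ, F) ∞ (fibreCoord x : TotalSpace F E → F) c :=
  (contMDiffOn_fibreCoord I x).contMDiffAt
    ((trivializationAt F E x).open_source.mem_nhds ((trivializationAt F E x).mem_source.2 hc))

lemma contMDiffAt_tangentFibreCoord {x : M} {u : TE I F E}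
    (hu : u.proj.proj ∈ (trivializationAt F E x).baseSet) :
    ContMDiffAt (I.prod 𝓘(ℝ, F)).tangent 𝓘(ℝ, F) ∞
      (tangentFibreCoord I x : TE I F E → F) u :=
  (contMDiff_snd_tangentBundle_modelSpace F 𝓘(ℝ, F)).contMDiffAt.comp u
    (contMDiffAt_tangentMap_of_isOpen (trivializationAt F E x).open_source
      (contMDiffOn_fibreCoord I x) u ((trivializationAt F E x).mem_source.2 hu))

lemma fibreCoord_injective {x m : M} (hm : m ∈ (trivializationAt F E x).baseSet) {b b' : E m}
    (h : fibreCoord x (⟨m, b⟩ : TotalSpace F E) = fibreCoord x ⟨m, b'⟩) : b = b' := by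
  have := congrArg ((trivializationAt F E x).symm m) h
  simpa only [fibreCoord, Trivialization.symm_apply_apply_mk _ hm] using this

/-- A tangent vector of `E` is determined by its image under `Tπ` and its fibre coordinates. -/
lemma tangent_ext {x : M} {u v : TE I F E}
    (hu : u.proj.proj ∈ (trivializationAt F E x).baseSet)
    (h1 : tangentProj I F E u = tangentProj I F E v)
    (h2 : fibreCoord x u.proj = fibreCoord x v.proj)
    (h3 : tangentFibreCoord I x u = tangentFibreCoord I x v) : u = v := by
  obtain ⟨⟨m, a⟩, u⟩ := u
  obtain ⟨⟨m', b⟩, v⟩ := v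
  obtain rfl : m = m' := congrArg TotalSpace.proj h1
  obtain rfl : a = b := fibreCoord_injective hu h2
  apply tangentBundle_mk_congr
  apply ((mdifferentiable_triv (F := F) (J := I) (V := E) x).mfderiv_injective
        (x := (⟨m, a⟩ : TotalSpace F E)) ((Trivialization.mem_source _).2 hu))
  refine (mfderiv_triv (J := I) x _ hu u).trans
    (Eq.trans (Prod.ext ?_ ?_) (mfderiv_triv (J := I) x _ hu v).symm)
  · exact eq_of_heq (TotalSpace.mk.inj h1).2
  · exact h3

/-- The tangent vector of `E` with image `y` under `Tπ` and given fibre coordinates. -/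
def tangentOfCoord (x : M) (y : TangentBundle I M) (p q : F) : TE I F E :=
  tangentMap (I.prod 𝓘(ℝ, F)) (I.prod 𝓘(ℝ, F))
    (trivializationAt F E x).toOpenPartialHomeomorph.symm
    ((equivTangentBundleProd I M 𝓘(ℝ, F) F).symm (y, ⟨p, q⟩))

lemma tangentOfCoord_proj_proj {x : M} {y : TangentBundle I M}
    (hy : y.proj ∈ (trivializationAt F E x).baseSet) (p q : F) :
    (tangentOfCoord I x y p q : TE I F E).proj.proj = y.proj :=
  (trivializationAt F E x).proj_symm_apply' hy

/-- Chain rule for chart ∘ inverse chart, which is the identity only near the point; hence the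
passage through germs. All coordinates of `tangentOfCoord` are read off from this. -/
lemma tangentMap_triv_tangentOfCoord {x : M} {y : TangentBundle I M}
    (hy : y.proj ∈ (trivializationAt F E x).baseSet) (p q : F) :
    tangentMap (I.prod 𝓘(ℝ, F)) (I.prod 𝓘(ℝ, F)) (trivializationAt F E x)
      (tangentOfCoord I x y p q) = (equivTangentBundleProd I M 𝓘(ℝ, F) F).symm (y, ⟨p, q⟩) := by
  have hd := mdifferentiable_triv (F := F) (J := I) (V := E) x
  have ht : (y.proj, p) ∈ (trivializationAt F E x).target :=
    (trivializationAt F E x).mem_target.2 hy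
  refine (tangentMap_comp_at _ (hd.mdifferentiableAt
    ((trivializationAt F E x).toOpenPartialHomeomorph.map_target ht))
    (hd.mdifferentiableAt_symm ht)).symm.trans ?_
  refine (tangentMap_congr_of_eventuallyEq (g := id) ?_).trans (congrFun tangentMap_id _)
  filter_upwards [(trivializationAt F E x).open_target.mem_nhds ht] with z hz
  exact (trivializationAt F E x).toOpenPartialHomeomorph.right_inv hz

lemma tangentProj_eq_tangentMap_fst {x : M} {u : TE I F E}
    (hu : u.proj.proj ∈ (trivializationAt F E x).baseSet) :
    tangentProj I F E u = tangentMap (I.prod 𝓘(ℝ, F)) I Prod.fst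
      (tangentMap (I.prod 𝓘(ℝ, F)) (I.prod 𝓘(ℝ, F)) (trivializationAt F E x) u) := by
  have hs := (trivializationAt F E x).mem_source.2 hu
  refine Eq.trans (tangentMap_congr_of_eventuallyEq ?_)
    (tangentMap_comp_at _ mdifferentiableAt_fst
      ((mdifferentiable_triv (F := F) (J := I) (V := E) x).mdifferentiableAt hs))
  filter_upwards [(trivializationAt F E x).open_source.mem_nhds hs] with c hc
  exact ((trivializationAt F E x).coe_fst hc).symm

lemma tangentMap_fibreCoord {x : M} {u : TE I F E}
    (hu : u.proj.proj ∈ (trivializationAt F E x).baseSet) :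
    tangentMap (I.prod 𝓘(ℝ, F)) 𝓘(ℝ, F) (fibreCoord x : TotalSpace F E → F) u =
      tangentMap (I.prod 𝓘(ℝ, F)) 𝓘(ℝ, F) Prod.snd
      (tangentMap (I.prod 𝓘(ℝ, F)) (I.prod 𝓘(ℝ, F)) (trivializationAt F E x) u) :=
  tangentMap_comp_at _ mdifferentiableAt_snd
      ((mdifferentiable_triv (F := F) (J := I) (V := E) x).mdifferentiableAt
        ((trivializationAt F E x).mem_source.2 hu))

lemma tangentProj_tangentOfCoord {x : M} {y : TangentBundle I M}
    (hy : y.proj ∈ (trivializationAt F E x).baseSet) (p q : F) :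
    tangentProj I F E (tangentOfCoord I x y p q) = y := by
  rw [tangentProj_eq_tangentMap_fst I (x := x) (by rwa [tangentOfCoord_proj_proj I hy]),
    tangentMap_triv_tangentOfCoord I hy, tangentMap_prodFst]
  rfl

lemma tangentMap_fibreCoord_tangentOfCoord {x : M} {y : TangentBundle I M}
    (hy : y.proj ∈ (trivializationAt F E x).baseSet) (p q : F) :
    tangentMap (I.prod 𝓘(ℝ, F)) 𝓘(ℝ, F) (fibreCoord x : TotalSpace F E → F)
      (tangentOfCoord I x y p q) = ⟨p, q⟩ := by
  rw [tangentMap_fibreCoord I (x := x) (by rwa [tangentOfCoord_proj_proj I hy]),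
    tangentMap_triv_tangentOfCoord I hy, tangentMap_prodSnd]
  rfl

lemma fibreCoord_tangentOfCoord {x : M} {y : TangentBundle I M}
    (hy : y.proj ∈ (trivializationAt F E x).baseSet) (p q : F) :
    fibreCoord x (tangentOfCoord I x y p q : TE I F E).proj = p :=
  congrArg TotalSpace.proj (tangentMap_fibreCoord_tangentOfCoord I (E := E) hy p q)

lemma tangentFibreCoord_tangentOfCoord {x : M} {y : TangentBundle I M}
    (hy : y.proj ∈ (trivializationAt F E x).baseSet) (p q : F) :
    tangentFibreCoord I x (tangentOfCoord I x y p q : TE I F E) = q :=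
  eq_of_heq (TotalSpace.mk.inj (tangentMap_fibreCoord_tangentOfCoord I (E := E) hy p q)).2

lemma tangentOfCoord_eq {x : M} {u : TE I F E}
    (hu : u.proj.proj ∈ (trivializationAt F E x).baseSet) :
    tangentOfCoord I x (tangentProj I F E u) (fibreCoord x u.proj) (tangentFibreCoord I x u) =
      u := by
  have hy : (tangentProj I F E u).proj ∈ (trivializationAt F E x).baseSet := hu
  exact tangent_ext I (x := x) (by rwa [tangentOfCoord_proj_proj I hy])
    (tangentProj_tangentOfCoord I hy _ _) (fibreCoord_tangentOfCoord I hy _ _)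
    (tangentFibreCoord_tangentOfCoord I hy _ _)

lemma contMDiffAt_tangentOfCoord {x : M} {y : TangentBundle I M}
    (hy : y.proj ∈ (trivializationAt F E x).baseSet) (p q : F) :
    ContMDiffAt (I.tangent.prod (𝓘(ℝ, F).prod 𝓘(ℝ, F))) (I.prod 𝓘(ℝ, F)).tangent ∞
      (fun z : TangentBundle I M × F × F => (tangentOfCoord I x z.1 z.2.1 z.2.2 : TE I F E))
      (y, p, q) := by
  have : IsManifold I 1 M := IsManifold.of_le (n := ∞) (by simp)
  -- The tangent bundle of `F` and the product `F × F` carry different manifold structures; the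
  -- evident map between them must be shown smooth.
  have h1 : ContMDiff (𝓘(ℝ, F).prod 𝓘(ℝ, F)) 𝓘(ℝ, F).tangent ∞
      (fun z : F × F => (⟨z.1, z.2⟩ : TangentBundle 𝓘(ℝ, F) F)) := by
    intro z
    refine contMDiffAt_totalSpace.2 ⟨contMDiffAt_fst, contMDiffAt_snd.congr_of_eventuallyEq ?_⟩
    exact Filter.Eventually.of_forall fun z' => by simp
  have h2 := (contMDiff_equivTangentBundleProd_symm (I := I) (M := M) (I' := 𝓘(ℝ, F))
    (M' := F) (n := ∞)).comp ((contMDiff_fst (I := I.tangent)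
      (J := 𝓘(ℝ, F).prod 𝓘(ℝ, F)) (M := TangentBundle I M) (N := F × F)).prodMk
      (h1.comp contMDiff_snd))
  exact (contMDiffAt_tangentMap_of_isOpen (trivializationAt F E x).open_target
    ((trivializationAt F E x).contMDiffOn_symm (IB := I) (n := ∞)) _
    ((trivializationAt F E x).mem_target.2 hy)).comp (y, p, q) h2.contMDiffAt

end Coordinates

/-! ### The operations of `Tπ : TE → TM` in coordinates. -/

section Operations

variable {EB : Type*} [NormedAddCommGroup EB] [NormedSpace ℝ EB]
  {HB : Type*} [TopologicalSpace HB] (I : ModelWithCorners ℝ EB HB)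
  {M : Type*} [TopologicalSpace M] [ChartedSpace HB M]
  {F : Type*} [NormedAddCommGroup F] [NormedSpace ℝ F]
  {E : M → Type*} [TopologicalSpace (TotalSpace F E)]
  [∀ x, AddCommMonoid (E x)] [∀ x, Module ℝ (E x)] [∀ x, TopologicalSpace (E x)]
  [FiberBundle F E] [VectorBundle ℝ F E]
  [IsManifold I ∞ M] [ContMDiffVectorBundle ∞ F E I]

lemma fibreCoord_add {x m : M} (hm : m ∈ (trivializationAt F E x).baseSet) (a b : E m) :
    fibreCoord x (⟨m, a + b⟩ : TotalSpace F E) = fibreCoord x ⟨m, a⟩ + fibreCoord x ⟨m, b⟩ :=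
  ((trivializationAt F E x).linear ℝ hm).map_add a b

lemma fibreCoord_smul {x m : M} (hm : m ∈ (trivializationAt F E x).baseSet) (r : ℝ) (a : E m) :
    fibreCoord x (⟨m, r • a⟩ : TotalSpace F E) = r • fibreCoord x ⟨m, a⟩ :=
  ((trivializationAt F E x).linear ℝ hm).map_smul r a

lemma eventually_proj_mem_baseSet {x : M} {c : TotalSpace F E}
    (hc : c.proj ∈ (trivializationAt F E x).baseSet) :
    ∀ᶠ c' : TotalSpace F E in nhds c, c'.proj ∈ (trivializationAt F E x).baseSet :=
  (FiberBundle.continuous_proj F E).continuousAt.eventually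
    ((trivializationAt F E x).open_baseSet.mem_nhds hc)

lemma fibreCoord_fibreAdd_eventuallyEq {x : M} {P : PullSpace I F E}
    (hP : P.proj.proj ∈ (trivializationAt F E x).baseSet) :
    (fun Q : PullSpace I F E => fibreCoord x (fibreAdd I Q)) =ᶠ[nhds P]
      (fun Q => fibreCoord x (pullFst I Q)) + fun Q => fibreCoord x (pullSnd I Q) := by
  have h : ∀ᶠ Q : PullSpace I F E in nhds P,
      Q.proj.proj ∈ (trivializationAt F E x).baseSet :=
    (contMDiff_pullFst I).continuous.continuousAt.eventually
      (eventually_proj_mem_baseSet (F := F) (E := E) (c := P.proj) hP)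
  filter_upwards [h] with Q hQ
  exact fibreCoord_add hQ _ _

/-- Differentiability is what gives `tauAdd` its meaning, since `mfderiv` is zero at points where a
map is not differentiable. -/
lemma contMDiff_fibreAdd : ContMDiff ((I.prod 𝓘(ℝ, F)).prod 𝓘(ℝ, F)) (I.prod 𝓘(ℝ, F)) ∞
    (fibreAdd I : PullSpace I F E → TotalSpace F E) := by
  intro P
  have hm : P.proj.proj ∈ (trivializationAt F E P.proj.proj).baseSet :=
    FiberBundle.mem_baseSet_trivializationAt' _
  refine contMDiffAt_totalSpace.2 ⟨((contMDiff_proj E).comp (contMDiff_pullFst I)) P, ?_⟩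
  have h1 : ContMDiffAt ((I.prod 𝓘(ℝ, F)).prod 𝓘(ℝ, F)) 𝓘(ℝ, F) ∞
      (fun Q : PullSpace I F E => fibreCoord P.proj.proj (pullFst I Q)) P :=
    ContMDiffAt.comp (g := fibreCoord P.proj.proj) (f := pullFst I) P
      (contMDiffAt_fibreCoord I (c := pullFst I P) hm) (contMDiff_pullFst I P)
  have h2 : ContMDiffAt ((I.prod 𝓘(ℝ, F)).prod 𝓘(ℝ, F)) 𝓘(ℝ, F) ∞
      (fun Q : PullSpace I F E => fibreCoord P.proj.proj (pullSnd I Q)) P :=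
    ContMDiffAt.comp (g := fibreCoord P.proj.proj) (f := pullSnd I) P
      (contMDiffAt_fibreCoord I (c := pullSnd I P) hm) (contMDiff_pullSnd I P)
  exact (h1.add h2).congr_of_eventuallyEq (fibreCoord_fibreAdd_eventuallyEq I hm)

lemma tangentEquiv_apply (W : TPull I F E) : tangentEquiv I W = tangentPair I W := rfl

lemma tauAdd_tangentPair (W : TPull I F E) : tauAdd I (tangentPair I W) =
    tangentMap ((I.prod 𝓘(ℝ, F)).prod 𝓘(ℝ, F)) (I.prod 𝓘(ℝ, F)) (fibreAdd I) W := by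
  rw [← tangentEquiv_apply, tauAdd, Equiv.symm_apply_apply]

lemma tangentProj_tauAdd (p : TProj2 I F E) :
    tangentProj I F E (tauAdd I p) = tangentProj I F E p.1.1 := by
  obtain ⟨W, rfl⟩ := (tangentPair_bijective I).2 p
  have hp := (contMDiff_proj (F := F) (n := ∞) (IB := I) E).mdifferentiable (by simp)
  rw [tauAdd_tangentPair]
  exact (tangentMap_comp_at W (hp _) ((contMDiff_fibreAdd I).mdifferentiable (by simp) _)).symm.trans
    (tangentMap_comp_at W (hp _) ((contMDiff_pullFst I).mdifferentiable (by simp) _))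

lemma fibreCoord_tauAdd {x : M} (p : TProj2 I F E)
    (hp : p.1.1.proj.proj ∈ (trivializationAt F E x).baseSet) :
    fibreCoord x (tauAdd I p).proj = fibreCoord x p.1.1.proj + fibreCoord x p.1.2.proj := by
  obtain ⟨W, rfl⟩ := (tangentPair_bijective I).2 p
  rw [tauAdd_tangentPair]
  exact fibreCoord_add (F := F) (E := E) hp _ _

lemma tangentFibreCoord_tangentMap {E₁ H₁ M₁ : Type*} [NormedAddCommGroup E₁] [NormedSpace ℝ E₁]
    [TopologicalSpace H₁] {I₁ : ModelWithCorners ℝ E₁ H₁}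
    [TopologicalSpace M₁] [ChartedSpace H₁ M₁] {x : M} {f : M₁ → TotalSpace F E}
    {W : TangentBundle I₁ M₁} (hf : MDifferentiableAt I₁ (I.prod 𝓘(ℝ, F)) f W.proj)
    (hW : (f W.proj).proj ∈ (trivializationAt F E x).baseSet) :
    tangentFibreCoord I x (tangentMap I₁ (I.prod 𝓘(ℝ, F)) f W) =
      mfderiv I₁ 𝓘(ℝ, F) (fun z => fibreCoord x (f z)) W.proj W.2 :=
  (DFunLike.congr_fun (mfderiv_comp W.proj
    ((contMDiffAt_fibreCoord I hW).mdifferentiableAt (by simp)) hf) W.2).symm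

/-- Every compatible pair comes from a tangent vector `W` of `π^*E`. There `tauAdd` is the
differential of the addition, whose fibre coordinate is locally the sum of those of the two
projections. -/
lemma tangentFibreCoord_tauAdd {x : M} (p : TProj2 I F E)
    (hp : p.1.1.proj.proj ∈ (trivializationAt F E x).baseSet) :
    tangentFibreCoord I x (tauAdd I p) =
      tangentFibreCoord I x p.1.1 + tangentFibreCoord I x p.1.2 := by
  obtain ⟨W, rfl⟩ := (tangentPair_bijective I).2 p
  have hW : W.proj.proj.proj ∈ (trivializationAt F E x).baseSet := hp
  have d1 := (contMDiff_pullFst I (F := F) (E := E)).mdifferentiable (by simp) W.proj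
  have d2 := (contMDiff_pullSnd I (F := F) (E := E)).mdifferentiable (by simp) W.proj
  have c1 : MDifferentiableAt ((I.prod 𝓘(ℝ, F)).prod 𝓘(ℝ, F)) 𝓘(ℝ, F)
      (fun Q : PullSpace I F E => fibreCoord x (pullFst I Q)) W.proj :=
    ((contMDiffAt_fibreCoord I (c := pullFst I W.proj) hW).mdifferentiableAt
      (by simp)).comp W.proj d1
  have c2 : MDifferentiableAt ((I.prod 𝓘(ℝ, F)).prod 𝓘(ℝ, F)) 𝓘(ℝ, F)
      (fun Q : PullSpace I F E => fibreCoord x (pullSnd I Q)) W.proj :=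
    ((contMDiffAt_fibreCoord I (c := pullSnd I W.proj) hW).mdifferentiableAt
      (by simp)).comp W.proj d2
  rw [tauAdd_tangentPair, tangentFibreCoord_tangentMap I
    ((contMDiff_fibreAdd I).mdifferentiable (by simp) _) hW]
  refine Eq.trans ?_ (congrArg₂ (· + ·) (tangentFibreCoord_tangentMap I d1 hW)
    (tangentFibreCoord_tangentMap I d2 hW)).symm
  refine (DFunLike.congr_fun (fibreCoord_fibreAdd_eventuallyEq I hW).mfderiv_eq W.2).trans ?_
  exact DFunLike.congr_fun (mfderiv_add c1 c2) W.2

lemma fibreCoord_tauSmul {x : M} (r : ℝ) {u : TE I F E}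
    (hu : u.proj.proj ∈ (trivializationAt F E x).baseSet) :
    fibreCoord x (tauSmul I r u).proj = r • fibreCoord x u.proj :=
  fibreCoord_smul (F := F) (E := E) hu r u.proj.2

lemma tangentFibreCoord_tauSmul {x : M} (r : ℝ) {u : TE I F E}
    (hu : u.proj.proj ∈ (trivializationAt F E x).baseSet) :
    tangentFibreCoord I x (tauSmul I r u) = r • tangentFibreCoord I x u := by
  rw [tauSmul, tangentFibreCoord_tangentMap I
    ((contMDiff_fibreSmul I r).mdifferentiable (by simp) _) hu]
  have h : (fun c : TotalSpace F E => fibreCoord x (fibreSmul r c)) =ᶠ[nhds u.proj]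
      r • fibreCoord x := by
    filter_upwards [eventually_proj_mem_baseSet (c := u.proj) hu] with c hc
    exact fibreCoord_smul (F := F) (E := E) hc r c.2
  refine (DFunLike.congr_fun h.mfderiv_eq u.2).trans ?_
  exact DFunLike.congr_fun (const_smul_mfderiv
    ((contMDiffAt_fibreCoord I hu).mdifferentiableAt (by simp)) r) u.2

end Operations

/-! ### Velocities of curves in `TE` over a fixed vector of `TM`, and the vertical projection. -/

section Velocity

variable {EB : Type*} [NormedAddCommGroup EB] [NormedSpace ℝ EB]
  {HB : Type*} [TopologicalSpace HB] (I : ModelWithCorners ℝ EB HB)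
  {M : Type*} [TopologicalSpace M] [ChartedSpace HB M]
  {F : Type*} [NormedAddCommGroup F] [NormedSpace ℝ F]
  {E : M → Type*} [TopologicalSpace (TotalSpace F E)]
  [∀ x, AddCommMonoid (E x)] [∀ x, Module ℝ (E x)] [∀ x, TopologicalSpace (E x)]
  [FiberBundle F E] [VectorBundle ℝ F E]
  [IsManifold I ∞ M] [ContMDiffVectorBundle ∞ F E I]

lemma tangentMap_curve {G : Type*} [NormedAddCommGroup G] [NormedSpace ℝ G] {γ : ℝ → G} {γ' : G}
    (h : HasDerivAt γ γ' 0) :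
    tangentMap 𝓘(ℝ, ℝ) 𝓘(ℝ, G) γ (⟨0, (1 : ℝ)⟩ : TangentBundle 𝓘(ℝ, ℝ) ℝ) = ⟨γ 0, γ'⟩ := by
  refine tangentBundle_mk_congr (I₁ := 𝓘(ℝ, G)) (x := γ 0) ?_
  rw [h.hasFDerivAt.hasMFDerivAt.mfderiv]
  exact one_smul ℝ γ'

lemma mdifferentiableAt_tangentOfCoord {x : M} {y : TangentBundle I M}
    (hy : y.proj ∈ (trivializationAt F E x).baseSet) (z : F × F) :
    MDifferentiableAt 𝓘(ℝ, F × F) (I.prod 𝓘(ℝ, F)).tangent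
      (fun z : F × F => (tangentOfCoord I x y z.1 z.2 : TE I F E)) z := by
  have h0 : ContMDiffAt (𝓘(ℝ, F).prod 𝓘(ℝ, F)) (I.tangent.prod (𝓘(ℝ, F).prod 𝓘(ℝ, F))) ∞
      (fun z : F × F => (y, z)) z := contMDiffAt_const.prodMk contMDiffAt_id
  have h1 := ContMDiffAt.comp (f := fun z : F × F => (y, z)) z
    (contMDiffAt_tangentOfCoord I (E := E) hy z.1 z.2) h0
  -- Replaces the model of the vector space `F × F` by the product of the two models of `F`.
  rw [modelWithCornersSelf_prod, ← chartedSpaceSelf_prod]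
  exact h1.mdifferentiableAt (by simp)

/-- The velocity of a curve in `TE` along which `Tπ` is constant, in coordinates. -/
lemma velocity_tangentOfCoord {x : M} {y : TangentBundle I M}
    (hy : y.proj ∈ (trivializationAt F E x).baseSet) {γ : ℝ → F × F} {γ' : F × F}
    (h : HasDerivAt γ γ' 0) :
    velocity I (fun s => (tangentOfCoord I x y (γ s).1 (γ s).2 : TE I F E)) =
      tangentMap 𝓘(ℝ, F × F) (I.prod 𝓘(ℝ, F)).tangent
        (fun z : F × F => (tangentOfCoord I x y z.1 z.2 : TE I F E))
        (⟨γ 0, γ'⟩ : TangentBundle 𝓘(ℝ, F × F) (F × F)) := by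
  rw [← tangentMap_curve h]
  refine tangentMap_comp_at (I := 𝓘(ℝ, ℝ)) (I' := 𝓘(ℝ, F × F))
    (I'' := (I.prod 𝓘(ℝ, F)).tangent) (f := γ)
    (g := fun z : F × F => (tangentOfCoord I x y z.1 z.2 : TE I F E))
    (⟨0, (1 : ℝ)⟩ : TangentBundle 𝓘(ℝ, ℝ) ℝ) ?_ h.hasFDerivAt.hasMFDerivAt.mdifferentiableAt
  exact mdifferentiableAt_tangentOfCoord I hy (γ 0)

/-- For fixed y, the coordinate map `R` is a differentiable left inverse of (p, q) ↦ (y, p, q).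
Applying its differential to a velocity therefore recovers the derivative of the coordinate curve.
-/
lemma eq_of_velocity_tangentOfCoord_eq {x : M} {y : TangentBundle I M}
    (hy : y.proj ∈ (trivializationAt F E x).baseSet) {γ δ : ℝ → F × F} {γ' δ' : F × F}
    (hγ : HasDerivAt γ γ' 0) (hδ : HasDerivAt δ δ' 0)
    (h : velocity I (fun s => (tangentOfCoord I x y (γ s).1 (γ s).2 : TE I F E)) =
      velocity I (fun s => (tangentOfCoord I x y (δ s).1 (δ s).2 : TE I F E))) : γ' = δ' := by
  let R : TE I F E → F × F := fun u => (fibreCoord x u.proj, tangentFibreCoord I x u)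
  have key : ∀ {α : ℝ → F × F} {α' : F × F}, HasDerivAt α α' 0 →
      tangentMap (I.prod 𝓘(ℝ, F)).tangent 𝓘(ℝ, F × F) R
        (velocity I (fun s => (tangentOfCoord I x y (α s).1 (α s).2 : TE I F E))) =
      ⟨α 0, α'⟩ := by
    intro α α' hα
    rw [velocity_tangentOfCoord I hy hα]
    have hu : (tangentOfCoord I x y (α 0).1 (α 0).2 : TE I F E).proj.proj ∈
        (trivializationAt F E x).baseSet := by rwa [tangentOfCoord_proj_proj I hy]
    have h3 : ContMDiffAt (I.prod 𝓘(ℝ, F)).tangent 𝓘(ℝ, F × F) ∞ R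
        (tangentOfCoord I x y (α 0).1 (α 0).2) :=
      ((contMDiffAt_fibreCoord I hu).comp _ (contMDiffAt_proj _)).prodMk_space
        (contMDiffAt_tangentFibreCoord I hu)
    refine (tangentMap_comp_at (I := 𝓘(ℝ, F × F)) (I'' := 𝓘(ℝ, F × F))
      (⟨α 0, α'⟩ : TangentBundle 𝓘(ℝ, F × F) (F × F))
      (h3.mdifferentiableAt (by simp))
      (mdifferentiableAt_tangentOfCoord I hy (α 0))).symm.trans ?_
    refine (tangentMap_congr_of_eventuallyEq (g := id) ?_).trans (congrFun tangentMap_id _)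
    exact Filter.Eventually.of_forall fun z => Prod.ext (fibreCoord_tangentOfCoord I hy _ _)
      (tangentFibreCoord_tangentOfCoord I hy _ _)
  have := (key hγ).symm.trans ((congrArg _ h).trans (key hδ))
  exact eq_of_heq (TotalSpace.mk.inj this).2

/-- The vertical lift of `Tπ` in coordinates. -/
lemma tauVerticalLift_eq {x : M} (p : TProj2 I F E)
    (hp : p.1.1.proj.proj ∈ (trivializationAt F E x).baseSet) :
    tauVerticalLift I p = velocity I (fun s : ℝ => (tangentOfCoord I x (tangentProj I F E p.1.1)
      ((fibreCoord x p.1.1.proj, tangentFibreCoord I x p.1.1) +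
        s • (fibreCoord x p.1.2.proj, tangentFibreCoord I x p.1.2)).1
      ((fibreCoord x p.1.1.proj, tangentFibreCoord I x p.1.1) +
        s • (fibreCoord x p.1.2.proj, tangentFibreCoord I x p.1.2)).2 : TE I F E)) := by
  have hq : p.1.2.proj.proj ∈ (trivializationAt F E x).baseSet := by
    have : p.1.1.proj.proj = p.1.2.proj.proj := congrArg (TotalSpace.proj : TangentBundle I M → M) p.2
    rwa [← this]
  unfold tauVerticalLift
  congr 1
  funext s
  let q : TProj2 I F E := ⟨(p.1.1, tauSmul I s p.1.2),
    p.2.trans (tangentProj_tauSmul I s p.1.2).symm⟩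
  have h0 := tangentProj_tauAdd I q
  have h1 := fibreCoord_tauAdd I (x := x) q hp
  have h2 := tangentFibreCoord_tauAdd I (x := x) q hp
  have hproj : (tangentProj I F E p.1.1).proj ∈ (trivializationAt F E x).baseSet := hp
  symm
  refine tangent_ext I (x := x) (by rwa [tangentOfCoord_proj_proj I hproj]) ?_ ?_ ?_
  · rw [tangentProj_tangentOfCoord I hproj, h0]
  · rw [fibreCoord_tangentOfCoord I hproj, h1, fibreCoord_tauSmul I s hq]
    rfl
  · rw [tangentFibreCoord_tangentOfCoord I hproj, h2,
      tangentFibreCoord_tauSmul I s hq]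
    rfl

lemma hasDerivAt_line {G : Type*} [NormedAddCommGroup G] [NormedSpace ℝ G] (a b : G) :
    HasDerivAt (fun s : ℝ => a + s • b) b 0 := by
  simpa using ((hasDerivAt_id (0 : ℝ)).smul_const b).const_add a

lemma tangentProj_tauVerticalLift_proj (p : TProj2 I F E) :
    tangentProj I F E (tauVerticalLift I p).proj = tangentProj I F E p.1.1 :=
  tangentProj_tauAdd I _

/-- Equal lifts have equal base points, hence the same image in `TM`, so both can be written as
velocities over one y in one chart. Their directions, which are the coordinates of the second
entries, then agree. -/
lemma tauVerticalLift_injective_snd {p q : TProj2 I F E}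
    (h : tauVerticalLift I p = tauVerticalLift I q) : p.1.2 = q.1.2 := by
  have hpr : tangentProj I F E p.1.1 = tangentProj I F E q.1.1 := by
    rw [← tangentProj_tauVerticalLift_proj, ← tangentProj_tauVerticalLift_proj, h]
  let x : M := p.1.1.proj.proj
  have hp : p.1.1.proj.proj ∈ (trivializationAt F E x).baseSet :=
    FiberBundle.mem_baseSet_trivializationAt' _
  have hq : q.1.1.proj.proj ∈ (trivializationAt F E x).baseSet := by
    have : p.1.1.proj.proj = q.1.1.proj.proj := congrArg (TotalSpace.proj : TangentBundle I M → M) hpr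
    rwa [← this]
  have hp2 : p.1.2.proj.proj ∈ (trivializationAt F E x).baseSet := by
    have : p.1.1.proj.proj = p.1.2.proj.proj := congrArg (TotalSpace.proj : TangentBundle I M → M) p.2
    rwa [← this]
  have hproj : (tangentProj I F E p.1.1).proj ∈ (trivializationAt F E x).baseSet := hp
  rw [tauVerticalLift_eq I p hp, tauVerticalLift_eq I q hq, ← hpr] at h
  have h2 := eq_of_velocity_tangentOfCoord_eq I hproj (hasDerivAt_line _ _)
    (hasDerivAt_line _ _) h
  exact tangent_ext I hp2 (p.2.symm.trans (hpr.trans q.2)) (Prod.ext_iff.1 h2).1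
    (Prod.ext_iff.1 h2).2

/-- The choice in the definition of `tauVerticalProj` is harmless, because a vertical lift
determines its second entry. -/
lemma tauVerticalProj_tauVerticalLift (p : TProj2 I F E) :
    tauVerticalProj I (tauVerticalLift I p) = p.1.2 := by
  have h : ∃ w v : TE I F E, ∃ hvw : tangentProj I F E v = tangentProj I F E w,
      tauVerticalLift I ⟨(v, w), hvw⟩ = tauVerticalLift I p := ⟨p.1.2, p.1.1, p.2, rfl⟩
  rw [tauVerticalProj, dif_pos h]
  obtain ⟨v, hvw, hV⟩ := h.choose_spec
  exact tauVerticalLift_injective_snd I hV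

/-- The vertical projection of the velocity of a curve in `TE` over a fixed tangent vector of `M`
and an affine curve in `E`. -/
lemma tauVerticalProj_velocity {x : M} {y : TangentBundle I M}
    (hy : y.proj ∈ (trivializationAt F E x).baseSet) (p q : F) {k : ℝ → F} {k' : F}
    (hk : HasDerivAt k k' 0) :
    tauVerticalProj I (velocity I fun s : ℝ => (tangentOfCoord I x y (p + s • q) (k s) :
      TE I F E)) = tangentOfCoord I x y q k' := by
  -- The velocity sees only first-order data: it is the vertical lift at the curve's value (y, p, k
  -- 0) in the direction (y, q, k').
  let P : TProj2 I F E := ⟨(tangentOfCoord I x y p (k 0), tangentOfCoord I x y q k'), by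
    rw [tangentProj_tangentOfCoord I hy, tangentProj_tangentOfCoord I hy]⟩
  have hP : P.1.1.proj.proj ∈ (trivializationAt F E x).baseSet := by
    change (tangentOfCoord I x y p (k 0) : TE I F E).proj.proj ∈ _
    rwa [tangentOfCoord_proj_proj I hy]
  refine Eq.trans (congrArg _ ?_) (tauVerticalProj_tauVerticalLift I P)
  rw [tauVerticalLift_eq I P hP]
  simp only [P, fibreCoord_tangentOfCoord I hy, tangentFibreCoord_tangentOfCoord I hy,
    tangentProj_tangentOfCoord I hy]
  rw [velocity_tangentOfCoord I hy ((hasDerivAt_line p q).prodMk hk),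
    velocity_tangentOfCoord I hy (hasDerivAt_line (p, k 0) (q, k'))]
  have e : (p + (0 : ℝ) • q, k 0) = (p, k 0) + (0 : ℝ) • (q, k') := by simp
  exact congrArg (fun z : F × F => tangentMap 𝓘(ℝ, F × F) (I.prod 𝓘(ℝ, F)).tangent
    (fun z : F × F => (tangentOfCoord I x y z.1 z.2 : TE I F E))
    (⟨z, (q, k')⟩ : TangentBundle 𝓘(ℝ, F × F) (F × F))) e

end Velocity

/-! ### Coordinates on `T(π^*E)`. -/

section Pullback

variable {EB : Type*} [NormedAddCommGroup EB] [NormedSpace ℝ EB]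
  {HB : Type*} [TopologicalSpace HB] (I : ModelWithCorners ℝ EB HB)
  {M : Type*} [TopologicalSpace M] [ChartedSpace HB M]
  {F : Type*} [NormedAddCommGroup F] [NormedSpace ℝ F]
  {E : M → Type*} [TopologicalSpace (TotalSpace F E)]
  [∀ x, AddCommMonoid (E x)] [∀ x, Module ℝ (E x)] [∀ x, TopologicalSpace (E x)]
  [FiberBundle F E] [VectorBundle ℝ F E]
  [IsManifold I ∞ M] [ContMDiffVectorBundle ∞ F E I]

/-- The chart of `π^*E` at c is pulled back from the chart of `E` at π(c), so its fibre coordinate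
is that of `E` composed with the second projection. -/
lemma tangentFibreCoord_pull {c : TotalSpace F E} (W : TPull I F E)
    (hW : W.proj.proj.proj ∈ (trivializationAt F E c.proj).baseSet) :
    tangentFibreCoord (I.prod 𝓘(ℝ, F)) c W = tangentFibreCoord I c.proj
      (tangentMap ((I.prod 𝓘(ℝ, F)).prod 𝓘(ℝ, F)) (I.prod 𝓘(ℝ, F)) (pullSnd I) W) :=
  (tangentFibreCoord_tangentMap I ((contMDiff_pullSnd I).mdifferentiable (by simp) _) hW).symm

end Pullback

/-! ### Connections in coordinates and the linearized connection. -/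

namespace EhresmannConnection

variable {EB : Type*} [NormedAddCommGroup EB] [NormedSpace ℝ EB]
  {HB : Type*} [TopologicalSpace HB] {I : ModelWithCorners ℝ EB HB}
  {M : Type*} [TopologicalSpace M] [ChartedSpace HB M]
  {F : Type*} [NormedAddCommGroup F] [NormedSpace ℝ F]
  {E : M → Type*} [TopologicalSpace (TotalSpace F E)]
  [∀ x, AddCommMonoid (E x)] [∀ x, Module ℝ (E x)] [∀ x, TopologicalSpace (E x)]
  [FiberBundle F E] [VectorBundle ℝ F E]
  [IsManifold I ∞ M] [ContMDiffVectorBundle ∞ F E I]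

/-- The local coefficient of a connection: the fibre coordinate of the horizontal lift of `y`
at the point with fibre coordinate `p`. -/
def localCoeff (H : EhresmannConnection I F E) (x : M) (y : TangentBundle I M) (p : F) : F :=
  tangentFibreCoord I x (H.hor ((trivializationAt F E x).symm y.proj p) y.2)

variable (H : EhresmannConnection I F E)

/-- No chart condition on m is needed: the point at which the lift is evaluated depends only on m
and p, and the lift is linear at every point. -/
lemma localCoeff_add (x m : M) (v v' : TangentSpace I m) (p : F) :
    H.localCoeff x ⟨m, v + v'⟩ p = H.localCoeff x ⟨m, v⟩ p + H.localCoeff x ⟨m, v'⟩ p := by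
  simp only [localCoeff, tangentFibreCoord, hor, map_add]
  exact (mfderiv (I.prod 𝓘(ℝ, F)) 𝓘(ℝ, F) (fibreCoord x : TotalSpace F E → F)
    ⟨m, (trivializationAt F E x).symm m p⟩).map_add _ _

lemma localCoeff_smul (x m : M) (r : ℝ) (v : TangentSpace I m) (p : F) :
    H.localCoeff x ⟨m, r • v⟩ p = r • H.localCoeff x ⟨m, v⟩ p := by
  simp only [localCoeff, tangentFibreCoord, hor, map_smul]
  exact (mfderiv (I.prod 𝓘(ℝ, F)) 𝓘(ℝ, F) (fibreCoord x : TotalSpace F E → F)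
    ⟨m, (trivializationAt F E x).symm m p⟩).map_smul _ _

lemma hor_eq_tangentOfCoord {x m : M} (hm : m ∈ (trivializationAt F E x).baseSet) (a : E m)
    (v : TangentSpace I m) : H.hor a v = tangentOfCoord I x ⟨m, v⟩
      (fibreCoord x (⟨m, a⟩ : TotalSpace F E))
      (H.localCoeff x ⟨m, v⟩ (fibreCoord x (⟨m, a⟩ : TotalSpace F E))) := by
  have h := tangentOfCoord_eq I (x := x) (u := H.hor a v) hm
  rw [H.tangentProj_hor] at h
  have ha : (trivializationAt F E x).symm m (fibreCoord x (⟨m, a⟩ : TotalSpace F E)) = a :=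
    (trivializationAt F E x).symm_apply_apply_mk hm a
  rw [localCoeff, ha]
  exact h.symm

/-- Γ is the composite of a local parametrization `f` of `π^*TM`, the horizontal lift, and the
tangent fibre coordinate. Joint smoothness in (y, p) is what later makes the fibre derivative
smooth. -/
lemma contMDiffAt_localCoeff {x : M} {y : TangentBundle I M}
    (hy : y.proj ∈ (trivializationAt F E x).baseSet) (p : F) :
    ContMDiffAt (I.tangent.prod 𝓘(ℝ, F)) 𝓘(ℝ, F) ∞
      (fun z : TangentBundle I M × F => H.localCoeff x z.1 z.2) (y, p) := by
  have : IsManifold I 1 M := IsManifold.of_le (n := ∞) (by simp)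
  let f : TangentBundle I M × F → PullTangent I F E := fun z =>
    ⟨⟨z.1.proj, (trivializationAt F E x).symm z.1.proj z.2⟩, z.1.2⟩
  have hpr : ContMDiff (I.tangent.prod 𝓘(ℝ, F)) (I.prod 𝓘(ℝ, F)) ∞
      (fun z : TangentBundle I M × F => (z.1.proj, z.2)) :=
    ((contMDiff_proj (TangentSpace I : M → Type _)).comp contMDiff_fst).prodMk contMDiff_snd
  have hf : ContMDiffAt (I.tangent.prod 𝓘(ℝ, F)) ((I.prod 𝓘(ℝ, F)).prod 𝓘(ℝ, EB)) ∞ f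
      (y, p) := by
    refine contMDiffAt_totalSpace.2 ⟨?_, ?_⟩
    · have h1 := (((trivializationAt F E x).contMDiffOn_symm (IB := I) (n := ∞)).contMDiffAt
        (x := (y.proj, p)) ((trivializationAt F E x).open_target.mem_nhds
          ((trivializationAt F E x).mem_target.2 hy)))
      refine (ContMDiffAt.comp (f := fun z : TangentBundle I M × F => (z.1.proj, z.2)) (y, p) h1
        (hpr (y, p))).congr_of_eventuallyEq ?_
      have h2 : ∀ᶠ z : TangentBundle I M × F in nhds (y, p),
          z.1.proj ∈ (trivializationAt F E x).baseSet :=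
        (continuous_fst.comp hpr.continuous).continuousAt.eventually
          ((trivializationAt F E x).open_baseSet.mem_nhds hy)
      filter_upwards [h2] with z hz
      exact (trivializationAt F E x).mk_symm hz z.2
    · have h1 : ContMDiffAt (I.tangent.prod 𝓘(ℝ, F)) (I.prod 𝓘(ℝ, EB)) ∞
        (fun z : TangentBundle I M × F => z.1) (y, p) := contMDiffAt_fst
      exact (contMDiffAt_totalSpace.1 h1).2
  have h3 := ContMDiffAt.comp (f := f) (y, p) (H.smooth_lift (f (y, p))) hf
  exact ContMDiffAt.comp (g := (tangentFibreCoord I x : TE I F E → F)) (y, p)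
    (contMDiffAt_tangentFibreCoord I (u := H.hor ((trivializationAt F E x).symm y.proj p) y.2) hy)
    h3

lemma differentiableAt_localCoeff {x : M} {y : TangentBundle I M}
    (hy : y.proj ∈ (trivializationAt F E x).baseSet) (p : F) :
    DifferentiableAt ℝ (H.localCoeff x y) p :=
  (ContMDiffAt.comp (f := fun q : F => (y, q)) p (H.contMDiffAt_localCoeff hy p)
    (contMDiffAt_const.prodMk contMDiffAt_id)).contDiffAt.differentiableAt (by simp)

/-- The fibre derivative of the local coefficient, in coordinates. -/
def localFibreDiff (x : M) (a b : TotalSpace F E) (y : TangentBundle I M) : F :=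
  fderiv ℝ (H.localCoeff x y) (fibreCoord x a) (fibreCoord x b)

/-- The heart of the proof: B(a, b)w = (Tπ(w), B, D_pΓ(Tπ(w), A)B). It holds in every chart whose
base set contains m, while the left side involves no chart. -/
lemma fibreDiff_eq {x m : M} (hm : m ∈ (trivializationAt F E x).baseSet) (a b : E m)
    (w : TangentSpace (I.prod 𝓘(ℝ, F)) (⟨m, a⟩ : TotalSpace F E)) :
    H.fibreDiff a b w = tangentOfCoord I x (tangentProj I F E ⟨⟨m, a⟩, w⟩)
      (fibreCoord x (⟨m, b⟩ : TotalSpace F E))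
      (H.localFibreDiff x ⟨m, a⟩ ⟨m, b⟩ (tangentProj I F E ⟨⟨m, a⟩, w⟩)) := by
  set y : TangentBundle I M := tangentProj I F E ⟨⟨m, a⟩, w⟩
  have hy : y.proj ∈ (trivializationAt F E x).baseSet := hm
  let A : F := fibreCoord x (⟨m, a⟩ : TotalSpace F E)
  let B : F := fibreCoord x (⟨m, b⟩ : TotalSpace F E)
  have hk : HasDerivAt (fun s : ℝ => H.localCoeff x y (A + s • B))
      (fderiv ℝ (H.localCoeff x y) A B) 0 := by
    have h1 : HasFDerivAt (H.localCoeff x y) (fderiv ℝ (H.localCoeff x y) A)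
        (A + (0 : ℝ) • B) := by
      rw [zero_smul, add_zero]
      exact (H.differentiableAt_localCoeff hy A).hasFDerivAt
    exact h1.comp_hasDerivAt (0 : ℝ) (hasDerivAt_line A B)
  refine Eq.trans (congrArg (fun c => tauVerticalProj I (velocity I c)) ?_)
    (tauVerticalProj_velocity I hy A B hk)
  funext s
  rw [H.hor_eq_tangentOfCoord hm, fibreCoord_add hm, fibreCoord_smul hm]
  rfl

/-! ### The lift on `π^*E` built from the fibre derivative. -/

/-- The fibre derivative of the local coefficient as a linear map of the tangent vector. -/
def localFibreDiffLinear (P : PullSpace I F E) :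
    TangentSpace (I.prod 𝓘(ℝ, F)) P.proj →ₗ[ℝ] F where
  toFun w := H.localFibreDiff P.proj.proj (pullFst I P) (pullSnd I P)
    (tangentProj I F E ⟨P.proj, w⟩)
  map_add' w w' := by
    have hm : P.proj.proj ∈ (trivializationAt F E P.proj.proj).baseSet :=
      FiberBundle.mem_baseSet_trivializationAt' _
    have h : H.localCoeff P.proj.proj (tangentProj I F E ⟨P.proj, w + w'⟩) =
        H.localCoeff P.proj.proj (tangentProj I F E ⟨P.proj, w⟩) +
        H.localCoeff P.proj.proj (tangentProj I F E ⟨P.proj, w'⟩) := by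
      funext p
      simp only [tangentProj, tangentMap, map_add]
      exact H.localCoeff_add _ _ _ _ _
    rw [localFibreDiff, h, fderiv_add (H.differentiableAt_localCoeff hm _)
      (H.differentiableAt_localCoeff hm _)]
    rfl
  map_smul' r w := by
    have hm : P.proj.proj ∈ (trivializationAt F E P.proj.proj).baseSet :=
      FiberBundle.mem_baseSet_trivializationAt' _
    have h : H.localCoeff P.proj.proj (tangentProj I F E ⟨P.proj, r • w⟩) =
        r • H.localCoeff P.proj.proj (tangentProj I F E ⟨P.proj, w⟩) := by
      funext p
      simp only [tangentProj, tangentMap, map_smul]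
      exact H.localCoeff_smul _ _ _ _ _
    rw [localFibreDiff, h, fderiv_const_smul (H.differentiableAt_localCoeff hm _)]
    rfl

/-- The horizontal lift of the linearization, as a linear map. -/
def linearizationLift (P : PullSpace I F E) : TangentSpace (I.prod 𝓘(ℝ, F)) P.proj →ₗ[ℝ]
    TangentSpace ((I.prod 𝓘(ℝ, F)).prod 𝓘(ℝ, F)) P :=
  ((mdifferentiable_triv (F := F) (J := I.prod 𝓘(ℝ, F)) (V := PullFibre I F E) P.proj).mfderiv
    (x := P) ((Trivialization.mem_source _).2
      (FiberBundle.mem_baseSet_trivializationAt' _))).symm.toLinearMap ∘ₗ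
    (LinearMap.id.prod (H.localFibreDiffLinear P) :
      TangentSpace (I.prod 𝓘(ℝ, F)) P.proj →ₗ[ℝ] (EB × F) × F)

lemma mfderiv_triv_linearizationLift (P : PullSpace I F E)
    (w : TangentSpace (I.prod 𝓘(ℝ, F)) P.proj) :
    mfderiv ((I.prod 𝓘(ℝ, F)).prod 𝓘(ℝ, F)) ((I.prod 𝓘(ℝ, F)).prod 𝓘(ℝ, F))
      (trivializationAt F (PullFibre I F E) P.proj) P (H.linearizationLift P w) =
      (w, H.localFibreDiffLinear P w) :=
  ((mdifferentiable_triv (F := F) (J := I.prod 𝓘(ℝ, F)) (V := PullFibre I F E) P.proj).mfderiv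
    (x := P) ((Trivialization.mem_source _).2
      (FiberBundle.mem_baseSet_trivializationAt' _))).apply_symm_apply
      ((w, H.localFibreDiffLinear P w) : (EB × F) × F)

lemma mfderiv_proj_linearizationLift (P : PullSpace I F E)
    (w : TangentSpace (I.prod 𝓘(ℝ, F)) P.proj) :
    mfderiv ((I.prod 𝓘(ℝ, F)).prod 𝓘(ℝ, F)) (I.prod 𝓘(ℝ, F))
      (TotalSpace.proj : PullSpace I F E → TotalSpace F E) P (H.linearizationLift P w) = w :=
  (Prod.ext_iff.1 ((mfderiv_triv (J := I.prod 𝓘(ℝ, F)) P.proj P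
    (FiberBundle.mem_baseSet_trivializationAt' _) _).symm.trans
    (H.mfderiv_triv_linearizationLift P w))).1

lemma tangentProj_linearizationLift (P : PullSpace I F E)
    (w : TangentSpace (I.prod 𝓘(ℝ, F)) P.proj) :
    tangentProj (I.prod 𝓘(ℝ, F)) F (PullFibre I F E) ⟨P, H.linearizationLift P w⟩ =
      ⟨P.proj, w⟩ :=
  tangentBundle_mk_congr (H.mfderiv_proj_linearizationLift P w)

/-- Identifies the lift intrinsically: both sides have the same three coordinates. The image in `TM`
agrees because the two projections of `π^*E` have the same composite with π. -/
lemma tangentMap_pullSnd_linearizationLift (P : PullSpace I F E)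
    (w : TangentSpace (I.prod 𝓘(ℝ, F)) P.proj) :
    tangentMap ((I.prod 𝓘(ℝ, F)).prod 𝓘(ℝ, F)) (I.prod 𝓘(ℝ, F)) (pullSnd I)
      (⟨P, H.linearizationLift P w⟩ : TPull I F E) = H.fibreDiff P.proj.2 P.2 w := by
  have hm : P.proj.proj ∈ (trivializationAt F E P.proj.proj).baseSet :=
    FiberBundle.mem_baseSet_trivializationAt' _
  have h1 : tangentProj I F E (tangentMap ((I.prod 𝓘(ℝ, F)).prod 𝓘(ℝ, F)) (I.prod 𝓘(ℝ, F))
      (pullSnd I) (⟨P, H.linearizationLift P w⟩ : TPull I F E)) =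
      tangentProj I F E ⟨P.proj, w⟩ :=
    (tangentProj_fst_eq_snd I _).symm.trans
      (congrArg (tangentProj I F E) (H.tangentProj_linearizationLift P w))
  have h2 : tangentFibreCoord (I.prod 𝓘(ℝ, F)) P.proj (⟨P, H.linearizationLift P w⟩ : TPull I F E) =
      H.localFibreDiffLinear P w :=
    (Prod.ext_iff.1 ((mfderiv_triv (J := I.prod 𝓘(ℝ, F)) P.proj P
      (FiberBundle.mem_baseSet_trivializationAt' _) _).symm.trans
      (H.mfderiv_triv_linearizationLift P w))).2
  rw [tangentFibreCoord_pull I _ hm] at h2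
  refine Eq.trans ?_ (H.fibreDiff_eq hm P.proj.2 P.2 w).symm
  have hy : (tangentProj I F E ⟨P.proj, w⟩).proj ∈
    (trivializationAt F E P.proj.proj).baseSet := hm
  refine tangent_ext I (x := P.proj.proj) hm ?_ ?_ ?_
  · exact h1.trans (tangentProj_tangentOfCoord I hy _ _).symm
  · exact (fibreCoord_tangentOfCoord I hy _ _).symm
  · exact h2.trans (tangentFibreCoord_tangentOfCoord I hy _ _).symm

/-- Frees the lift from the chart centred at `P`: the chart-free `fibreDiff` is expanded again in
the chart at `c`. -/
lemma tangentFibreCoord_linearizationLift {c : TotalSpace F E} (P : PullSpace I F E)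
    (hP : P.proj.proj ∈ (trivializationAt F E c.proj).baseSet)
    (w : TangentSpace (I.prod 𝓘(ℝ, F)) P.proj) :
    tangentFibreCoord (I.prod 𝓘(ℝ, F)) c (⟨P, H.linearizationLift P w⟩ : TPull I F E) =
      H.localFibreDiff c.proj (pullFst I P) (pullSnd I P) (tangentProj I F E ⟨P.proj, w⟩) := by
  rw [tangentFibreCoord_pull I _ hP, tangentMap_pullSnd_linearizationLift]
  refine (congrArg _ (H.fibreDiff_eq hP P.proj.2 P.2 w)).trans ?_
  exact tangentFibreCoord_tangentOfCoord I
    (show (tangentProj I F E ⟨P.proj, w⟩).proj ∈ (trivializationAt F E c.proj).baseSet from hP) _ _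

lemma linearizationLift_eq_tangentOfCoord {c : TotalSpace F E} (P : PullSpace I F E)
    (hP : P.proj.proj ∈ (trivializationAt F E c.proj).baseSet)
    (w : TangentSpace (I.prod 𝓘(ℝ, F)) P.proj) :
    (⟨P, H.linearizationLift P w⟩ : TPull I F E) =
      tangentOfCoord (I.prod 𝓘(ℝ, F)) (E := PullFibre I F E) c ⟨P.proj, w⟩
        (fibreCoord c P)
        (H.localFibreDiff c.proj (pullFst I P) (pullSnd I P)
          (tangentProj I F E ⟨P.proj, w⟩)) := by
  have h := tangentOfCoord_eq (I.prod 𝓘(ℝ, F)) (E := PullFibre I F E) (x := c)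
    (u := ⟨P, H.linearizationLift P w⟩) hP
  rw [H.tangentProj_linearizationLift, H.tangentFibreCoord_linearizationLift P hP] at h
  exact h.symm

/-- The derivative in p of a jointly smooth family, evaluated at a smoothly varying point and
applied to a smoothly varying vector, is smooth. -/
lemma contMDiffAt_localFibreDiff {EN HN N : Type*} [NormedAddCommGroup EN] [NormedSpace ℝ EN]
    [TopologicalSpace HN] {J : ModelWithCorners ℝ EN HN} [TopologicalSpace N]
    [ChartedSpace HN N] [IsManifold J ∞ N] {x : M} {α β : N → TotalSpace F E}
    {η : N → TangentBundle I M} {n : N}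
    (hα : ContMDiffAt J (I.prod 𝓘(ℝ, F)) ∞ α n) (hβ : ContMDiffAt J (I.prod 𝓘(ℝ, F)) ∞ β n)
    (hη : ContMDiffAt J I.tangent ∞ η n)
    (hαx : (α n).proj ∈ (trivializationAt F E x).baseSet)
    (hβx : (β n).proj ∈ (trivializationAt F E x).baseSet)
    (hηx : (η n).proj ∈ (trivializationAt F E x).baseSet) :
    ContMDiffAt J 𝓘(ℝ, F) ∞ (fun n => H.localFibreDiff x (α n) (β n) (η n)) n := by
  have : IsManifold J 1 N := IsManifold.of_le (n := ∞) (by simp)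
  have hA : ContMDiffAt J 𝓘(ℝ, F) ∞ (fun n => fibreCoord x (α n)) n :=
    (contMDiffAt_fibreCoord I hαx).comp n hα
  have hB : ContMDiffAt J 𝓘(ℝ, F) ∞ (fun n => fibreCoord x (β n)) n :=
    (contMDiffAt_fibreCoord I hβx).comp n hβ
  have hf : ContMDiffAt (J.prod 𝓘(ℝ, F)) 𝓘(ℝ, F) ∞
      (Function.uncurry fun n p => H.localCoeff x (η n) p) (n, fibreCoord x (α n)) :=
    ContMDiffAt.comp (f := fun z : N × F => (η z.1, z.2)) (n, fibreCoord x (α n))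
      (H.contMDiffAt_localCoeff hηx _)
      ((ContMDiffAt.comp (f := Prod.fst) (n, fibreCoord x (α n)) hη contMDiffAt_fst).prodMk
        contMDiffAt_snd)
  have h := ContMDiffAt.mfderiv (m := ∞) (fun n p => H.localCoeff x (η n) p)
    (fun n => fibreCoord x (α n)) hf hA (by simp)
  -- `ContMDiffAt.mfderiv` expresses the derivative in tangent coordinates, which are trivial for
  -- maps between vector spaces.
  have e := inTangentCoordinates_model_space (I := 𝓘(ℝ, F)) (I' := 𝓘(ℝ, F))
    (fun n => fibreCoord x (α n)) (fun n => H.localCoeff x (η n) (fibreCoord x (α n)))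
    (fun n => fderiv ℝ (H.localCoeff x (η n)) (fibreCoord x (α n))) n
  simp only [mfderiv_eq_fderiv] at h
  exact (e ▸ h : ContMDiffAt J 𝓘(ℝ, F →L[ℝ] F) ∞
    (fun n => fderiv ℝ (H.localCoeff x (η n)) (fibreCoord x (α n))) n).clm_apply hB

lemma contMDiff_linearizationLift :
    ContMDiff (((I.prod 𝓘(ℝ, F)).prod 𝓘(ℝ, F)).prod 𝓘(ℝ, EB × F))
      ((I.prod 𝓘(ℝ, F)).prod 𝓘(ℝ, F)).tangent ∞
    (fun p : PullTangent (I.prod 𝓘(ℝ, F)) F (PullFibre I F E) =>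
      (⟨p.proj, H.linearizationLift p.proj p.2⟩ : TPull I F E)) := by
  intro p₀
  let c : TotalSpace F E := p₀.proj.proj
  let Q := PullTangent (I.prod 𝓘(ℝ, F)) F (PullFibre I F E)
  have hc : c.proj ∈ (trivializationAt F E c.proj).baseSet :=
    FiberBundle.mem_baseSet_trivializationAt' _
  have hpr : ContMDiff (((I.prod 𝓘(ℝ, F)).prod 𝓘(ℝ, F)).prod 𝓘(ℝ, EB × F))
      ((I.prod 𝓘(ℝ, F)).prod 𝓘(ℝ, F)) ∞ (fun p : Q => p.proj) := contMDiff_proj _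
  have hfst := (contMDiff_pullFst I (F := F) (E := E)).comp hpr
  have hsnd := (contMDiff_pullSnd I (F := F) (E := E)).comp hpr
  have hw : ContMDiffAt (((I.prod 𝓘(ℝ, F)).prod 𝓘(ℝ, F)).prod 𝓘(ℝ, EB × F))
      (I.prod 𝓘(ℝ, F)).tangent ∞ (fun p : Q => (⟨p.proj.proj, p.2⟩ : TE I F E)) p₀ := by
    refine contMDiffAt_totalSpace.2 ⟨hfst p₀, ?_⟩
    have h : ContMDiffAt (((I.prod 𝓘(ℝ, F)).prod 𝓘(ℝ, F)).prod 𝓘(ℝ, EB × F))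
      (((I.prod 𝓘(ℝ, F)).prod 𝓘(ℝ, F)).prod 𝓘(ℝ, EB × F)) ∞ (fun p : Q => p) p₀ :=
      contMDiffAt_id
    exact (contMDiffAt_totalSpace.1 h).2
  have : IsManifold I 1 M := IsManifold.of_le (n := ∞) (by simp)
  have : IsManifold (I.prod 𝓘(ℝ, F)) 1 (TotalSpace F E) := IsManifold.of_le (n := ∞) (by simp)
  have hT : ContMDiff (I.prod 𝓘(ℝ, F)).tangent I.tangent ∞ (tangentProj I F E) :=
    (contMDiff_proj (F := F) (n := ∞) (IB := I) E).contMDiff_tangentMap (by simp)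
  have hη := ContMDiffAt.comp p₀ (hT _) hw
  have hd := H.contMDiffAt_localFibreDiff (x := c.proj) (hfst p₀) (hsnd p₀) hη hc hc hc
  have hb : ContMDiffAt (((I.prod 𝓘(ℝ, F)).prod 𝓘(ℝ, F)).prod 𝓘(ℝ, EB × F)) 𝓘(ℝ, F) ∞
      (fun p : Q => fibreCoord c p.proj) p₀ :=
    ContMDiffAt.comp (g := (fibreCoord c : PullSpace I F E → F)) p₀
      (contMDiffAt_fibreCoord (I.prod 𝓘(ℝ, F)) (E := PullFibre I F E) (c := p₀.proj) hc) (hpr p₀)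
  have hG := contMDiffAt_tangentOfCoord (I.prod 𝓘(ℝ, F)) (E := PullFibre I F E) (x := c)
    (y := ⟨p₀.proj.proj, p₀.2⟩) hc (fibreCoord c p₀.proj)
    (H.localFibreDiff c.proj (pullFst I p₀.proj) (pullSnd I p₀.proj)
      (tangentProj I F E ⟨p₀.proj.proj, p₀.2⟩))
  refine (hG.comp p₀ (hw.prodMk (hb.prodMk hd))).congr_of_eventuallyEq ?_
  have hev : ∀ᶠ p : Q in nhds p₀, p.proj.proj.proj ∈ (trivializationAt F E c.proj).baseSet :=
    hfst.continuous.continuousAt.eventually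
      (eventually_proj_mem_baseSet (F := F) (E := E) (c := c) hc)
  filter_upwards [hev] with p hp
  exact H.linearizationLift_eq_tangentOfCoord p.proj hp p.2

/-- The linearization of a connection on `E → M`, a connection on `π^*E → E`. -/
def linearization : EhresmannConnection (I.prod 𝓘(ℝ, F)) F (PullFibre I F E) where
  lift := H.linearizationLift
  proj_lift := H.mfderiv_proj_linearizationLift
  smooth_lift := H.contMDiff_linearizationLift

/-- Coordinates are compared in the chart at a. The only analytic content is that D_pΓ(y, A) is
linear in B. -/
lemma isLinear_linearization : H.linearization.IsLinear := by
  constructor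
  · intro a b b' w
    have ha : a.proj ∈ (trivializationAt F E a.proj).baseSet :=
      FiberBundle.mem_baseSet_trivializationAt' _
    let p : TProj2 (I.prod 𝓘(ℝ, F)) F (PullFibre I F E) :=
      ⟨(H.linearization.hor b w, H.linearization.hor b' w),
        (H.linearization.tangentProj_hor b w).trans (H.linearization.tangentProj_hor b' w).symm⟩
    have hab : a ∈ (trivializationAt F (PullFibre I F E) a).baseSet := ha
    refine tangent_ext (I.prod 𝓘(ℝ, F)) (x := a) ha ?_ ?_ ?_
    · exact (H.linearization.tangentProj_hor _ w).trans
        ((H.linearization.tangentProj_hor _ w).symm.trans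
          (tangentProj_tauAdd (I.prod 𝓘(ℝ, F)) p).symm)
    · exact (fibreCoord_add hab b b').trans
        (fibreCoord_tauAdd (I.prod 𝓘(ℝ, F)) (x := a) p ha).symm
    · refine Eq.trans ?_ (tangentFibreCoord_tauAdd (I.prod 𝓘(ℝ, F)) (x := a) p ha).symm
      refine (H.tangentFibreCoord_linearizationLift (c := a) ⟨a, b + b'⟩ ha w).trans
        (Eq.trans ?_ (congrArg₂ (· + ·)
          (H.tangentFibreCoord_linearizationLift (c := a) ⟨a, b⟩ ha w)
          (H.tangentFibreCoord_linearizationLift (c := a) ⟨a, b'⟩ ha w)).symm)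
      have hadd : fibreCoord a.proj (pullSnd I (⟨a, b + b'⟩ : PullSpace I F E)) =
          fibreCoord a.proj (pullSnd I (⟨a, b⟩ : PullSpace I F E)) +
          fibreCoord a.proj (pullSnd I (⟨a, b'⟩ : PullSpace I F E)) := fibreCoord_add hab b b'
      rw [localFibreDiff, hadd, map_add]
      rfl
  · intro a r b w
    have ha : a.proj ∈ (trivializationAt F E a.proj).baseSet :=
      FiberBundle.mem_baseSet_trivializationAt' _
    have hab : a ∈ (trivializationAt F (PullFibre I F E) a).baseSet := ha
    refine tangent_ext (I.prod 𝓘(ℝ, F)) (x := a) ha ?_ ?_ ?_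
    · exact (H.linearization.tangentProj_hor _ w).trans
        ((H.linearization.tangentProj_hor _ w).symm.trans
          (tangentProj_tauSmul (I.prod 𝓘(ℝ, F)) r _).symm)
    · exact (fibreCoord_smul hab r b).trans
        (fibreCoord_tauSmul (I.prod 𝓘(ℝ, F)) (x := a) r
          (u := H.linearization.hor b w) ha).symm
    · refine Eq.trans ?_ (tangentFibreCoord_tauSmul (I.prod 𝓘(ℝ, F)) (x := a) r
        (u := H.linearization.hor b w) ha).symm
      refine (H.tangentFibreCoord_linearizationLift (c := a) ⟨a, r • b⟩ ha w).trans
        (Eq.trans ?_ (congrArg (r • ·)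
          (H.tangentFibreCoord_linearizationLift (c := a) ⟨a, b⟩ ha w)).symm)
      have hsmul : fibreCoord a.proj (pullSnd I (⟨a, r • b⟩ : PullSpace I F E)) =
          r • fibreCoord a.proj (pullSnd I (⟨a, b⟩ : PullSpace I F E)) := fibreCoord_smul hab r b
      rw [localFibreDiff, hsmul, map_smul]
      rfl

lemma tangentEquiv_linearization_hor {m : M} (a b : E m)
    (w : TangentSpace (I.prod 𝓘(ℝ, F)) (⟨m, a⟩ : TotalSpace F E)) :
    (tangentEquiv I (H.linearization.hor (m := (⟨m, a⟩ : TotalSpace F E)) b w)).1 =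
      (⟨⟨m, a⟩, w⟩, H.fibreDiff a b w) :=
  Prod.ext (H.tangentProj_linearizationLift ⟨⟨m, a⟩, b⟩ w)
    (H.tangentMap_pullSnd_linearizationLift ⟨⟨m, a⟩, b⟩ w)

end EhresmannConnection

end NonlinearConnection

end

theorem theorem3p1 {EB : Type*} [NormedAddCommGroup EB] [NormedSpace ℝ EB] [CompleteSpace EB]
    {HB : Type*} [TopologicalSpace HB] (I : ModelWithCorners ℝ EB HB) [I.Boundaryless]
    {M : Type*} [TopologicalSpace M] [ChartedSpace HB M] [IsManifold I ∞ M]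
    (F : Type*) [NormedAddCommGroup F] [NormedSpace ℝ F] [CompleteSpace F]
    (E : M → Type*) [TopologicalSpace (TotalSpace F E)]
    [∀ x, AddCommMonoid (E x)] [∀ x, Module ℝ (E x)] [∀ x, TopologicalSpace (E x)]
    [FiberBundle F E] [VectorBundle ℝ F E] [ContMDiffVectorBundle ∞ F E I]
    (H : NonlinearConnection.EhresmannConnection I F E) :
    ∃ Hbar : NonlinearConnection.EhresmannConnection (I.prod 𝓘(ℝ, F)) F
        (NonlinearConnection.PullFibre I F E),
      Hbar.IsLinear ∧
      ∀ (m : M) (a b : E m)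
        (w : TangentSpace (I.prod 𝓘(ℝ, F)) (⟨m, a⟩ : TotalSpace F E)),
        (NonlinearConnection.tangentEquiv I (Hbar.hor (m := (⟨m, a⟩ : TotalSpace F E)) b w)).1 =
          (⟨⟨m, a⟩, w⟩, H.fibreDiff a b w) :=
  ⟨H.linearization, H.isLinear_linearization, fun _ a b w =>
    H.tangentEquiv_linearization_hor a b w⟩
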